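/- Conventions. For a bounded linear operator $T$ on a complex Banach space $Z$, let $\sigma(T)$ be its spectrum, $N(T)$ its null space, $R(T)$ its range, $\alpha(T)=\dim N(T)$, $\beta(T)=\dim Z/R(T)$, and $T^*\in L(Z^*)$ its adjoint, $T^*f=f\circ T$. For $K\subseteq\mathbb C$ let $\mathrm{iso}\,K$ be the set of isolated points of $K$. $T$ is *Fredholm* if $\alpha(T),\beta(T)<\infty$, and then $\mathrm{ind}(T)=\alpha(T)-\beta(T)$; $T$ is *Weyl* if it is Fredholm with $\mathrm{ind}(T)=0$; $T$ is *B-Weyl* if for some $n\in\mathbb N$ the range $R(T^n)$ is closed and the operator $T_n\colon R(T^n)\to R(T^n)$ induced by $T$ is Fredholm of index $0$. Put $\sigma_w(T)=\{\lambda\in\mathbb C: T-\lambda \text{ is not Weyl}\}$ and $\sigma_{BW}(T)=\{\lambda\in\mathbb C: T-\lambda\text{ is not B-Weyl}\}$. The ascent (descent) of $T$ is the least $n\ge 0$ with $N(T^n)=N(T^{n+1})$ (with $R(T^n)=R(T^{n+1})$), or $\infty$ if there is none. Let $$\Pi(T)=\{\lambda\in\sigma(T): asc(T-\lambda)=dsc(T-\lambda)<\infty\},\qquad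 \Pi_0(T)=\{\lambda\in\Pi(T):\alpha(T-\lambda)<\infty\},$$ $$E(T)=\{\lambda\in\mathrm{iso}\,\sigma(T):\alpha(T-\lambda)>0\},\qquad E_0(T)=\{\lambda\in E(T):\alpha(T-\lambda)<\infty\}.$$ $T$ is *isoloid* if $\mathrm{iso}\,\sigma(T)=E(T)$. One says that, for $T$, *Browder's theorem* holds if $\sigma_w(T)=\sigma(T)\setminus\Pi_0(T)$; *generalized Browder's theorem* holds if $\sigma_{BW}(T)=\sigma(T)\setminus\Pi(T)$; *Weyl's theorem* holds if $\sigma_w(T)=\sigma(T)\setminus E_0(T)$; *generalized Weyl's theorem* holds if $\sigma_{BW}(T)=\sigma(T)\setminus E(T)$. Theorem 5.3. Let $X$ and $Y$ be complex Banach spaces and let $A\in L(X)$ and $B\in L(Y)$ be such that $A$ and $B^*$ are isoloid and generalized Weyl's theorem holds for $A$ and for $B^*$. Let $\rho\in L(L(Y,X))$ be the generalized derivation $\rho(U)=AU-UB$. Then the following statements are equivalent: 1. generalized Weyl's theorem holds for $\rho$; 2. Browder's theorem holds for $\rho$; 3. generalized Browder's theorem holds for $\rho$; 4. Browder's theorem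 holds for $\rho^*\in L(L(Y,X)^*)$; 5. generalized Browder's theorem holds for $\rho^*$; 6. generalized Weyl's theorem holds for $\rho^*$; 7. Weyl's theorem holds for $\rho$; 8. Weyl's theorem holds for $\rho^*$. -/

import Mathlib

/-! Fredholm-type notions, poles, isolated eigenvalues and the Browder / Weyl type theorems for a
bounded operator on a complex Banach space, and the generalized derivation of two operators. -/

namespace WeylBrowder

/-- A linear operator is Fredholm if its null space is finite dimensional and its range has finite
codimension. (For bounded operators on Banach spaces this forces the range to be closed.) -/
def IsFredholm {V : Type*} [AddCommGroup V] [Module ℂ V] (T : V →ₗ[ℂ] V) : Prop :=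
  FiniteDimensional ℂ T.ker ∧ FiniteDimensional ℂ (V ⧸ T.range)

/-- The index `dim N(T) - dim V / R(T)`, meaningful for Fredholm operators. -/
noncomputable def index {V : Type*} [AddCommGroup V] [Module ℂ V] (T : V →ₗ[ℂ] V) : ℤ :=
  (Module.finrank ℂ T.ker : ℤ) - (Module.finrank ℂ (V ⧸ T.range) : ℤ)

/-- Weyl operators: Fredholm operators of index zero. -/
def IsWeyl {V : Type*} [AddCommGroup V] [Module ℂ V] (T : V →ₗ[ℂ] V) : Prop :=
  IsFredholm T ∧ index T = 0

/-- The subspace `R(Tⁿ)` is invariant under `T`. -/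
theorem mapsTo_range_pow {V : Type*} [AddCommGroup V] [Module ℂ V] (T : V →ₗ[ℂ] V) (n : ℕ) :
    ∀ x ∈ (T ^ n).range, T x ∈ (T ^ n).range := by
  rintro _ ⟨y, rfl⟩
  exact ⟨T y, by rw [← Module.End.mul_apply, ← Module.End.mul_apply, ← pow_succ, ← pow_succ']⟩

/-- The operator `T_n : R(Tⁿ) → R(Tⁿ)` induced by `T`. -/
def restrictRangePow {V : Type*} [AddCommGroup V] [Module ℂ V] (T : V →ₗ[ℂ] V) (n : ℕ) :
    (T ^ n).range →ₗ[ℂ] (T ^ n).range :=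
  T.restrict (mapsTo_range_pow T n)

/-- The ascent of `T`: the least `n` with `N(Tⁿ) = N(Tⁿ⁺¹)`, and `⊤` if there is none. -/
noncomputable def ascent {V : Type*} [AddCommGroup V] [Module ℂ V] (T : V →ₗ[ℂ] V) : ℕ∞ :=
  ⨅ (n : ℕ) (_ : (T ^ n).ker = (T ^ (n + 1)).ker), (n : ℕ∞)

/-- The descent of `T`: the least `n` with `R(Tⁿ) = R(Tⁿ⁺¹)`, and `⊤` if there is none. -/
noncomputable def descent {V : Type*} [AddCommGroup V] [Module ℂ V] (T : V →ₗ[ℂ] V) : ℕ∞ :=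
  ⨅ (n : ℕ) (_ : (T ^ n).range = (T ^ (n + 1)).range), (n : ℕ∞)

/-- The isolated points of a set of complex numbers. -/
def iso (K : Set ℂ) : Set ℂ := K \ derivedSet K

section Operators

variable {E : Type*} [NormedAddCommGroup E] [NormedSpace ℂ E]

/-- `T` is B-Weyl: for some `n` the range of `Tⁿ` is closed and `T_n` is Fredholm of index zero.
(On a Banach space, if `R(Tⁿ)` is closed and `T_n` is Fredholm, then so it is for every `m ≥ n`,
with the same index; thus this says that `T` is B-Fredholm and its index is zero.) -/
def IsBWeyl (T : E →L[ℂ] E) : Prop :=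
  ∃ n : ℕ, IsClosed (((T : E →ₗ[ℂ] E) ^ n).range : Set E) ∧
    IsWeyl (restrictRangePow (T : E →ₗ[ℂ] E) n)

/-- The operator `T - z`. -/
def shift (T : E →L[ℂ] E) (z : ℂ) : E →L[ℂ] E := T - z • ContinuousLinearMap.id ℂ E

/-- The Weyl spectrum. -/
def weylSpectrum (T : E →L[ℂ] E) : Set ℂ :=
  {z | ¬ IsWeyl (shift T z : E →ₗ[ℂ] E)}

/-- The B-Weyl spectrum. -/
def bWeylSpectrum (T : E →L[ℂ] E) : Set ℂ :=
  {z | ¬ IsBWeyl (shift T z)}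

/-- The poles of (the resolvent of) `T`: the points `z` of the spectrum for which the ascent and the
descent of `T - z` are finite and equal. -/
def poles (T : E →L[ℂ] E) : Set ℂ :=
  {z | z ∈ spectrum ℂ T ∧ ascent (shift T z : E →ₗ[ℂ] E) = descent (shift T z : E →ₗ[ℂ] E) ∧
    ascent (shift T z : E →ₗ[ℂ] E) < ⊤}

/-- The poles of finite rank. -/
def finitePoles (T : E →L[ℂ] E) : Set ℂ :=
  {z | z ∈ poles T ∧ FiniteDimensional ℂ (shift T z : E →ₗ[ℂ] E).ker}

/-- The eigenvalues of `T` that are isolated points of the spectrum. -/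
def isoEigenvalues (T : E →L[ℂ] E) : Set ℂ :=
  {z | z ∈ iso (spectrum ℂ T) ∧ (shift T z : E →ₗ[ℂ] E).ker ≠ ⊥}

/-- The eigenvalues of `T` of finite multiplicity that are isolated points of the spectrum. -/
def finiteIsoEigenvalues (T : E →L[ℂ] E) : Set ℂ :=
  {z | z ∈ isoEigenvalues T ∧ FiniteDimensional ℂ (shift T z : E →ₗ[ℂ] E).ker}

/-- `T` is isoloid: every isolated point of the spectrum is an eigenvalue. -/
def IsIsoloid (T : E →L[ℂ] E) : Prop :=
  iso (spectrum ℂ T) = isoEigenvalues T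

/-- Browder's theorem holds for `T`. -/
def BrowderTheorem (T : E →L[ℂ] E) : Prop :=
  weylSpectrum T = spectrum ℂ T \ finitePoles T

/-- Generalized Browder's theorem holds for `T`. -/
def GeneralizedBrowderTheorem (T : E →L[ℂ] E) : Prop :=
  bWeylSpectrum T = spectrum ℂ T \ poles T

/-- Weyl's theorem holds for `T`. -/
def WeylTheorem (T : E →L[ℂ] E) : Prop :=
  weylSpectrum T = spectrum ℂ T \ finiteIsoEigenvalues T

/-- Generalized Weyl's theorem holds for `T`. -/
def GeneralizedWeylTheorem (T : E →L[ℂ] E) : Prop :=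
  bWeylSpectrum T = spectrum ℂ T \ isoEigenvalues T

/-- The (Banach space) adjoint `T* : E* → E*`, `f ↦ f ∘ T`. -/
noncomputable def adjoint (T : E →L[ℂ] E) : StrongDual ℂ E →L[ℂ] StrongDual ℂ E :=
  ContinuousLinearMap.precomp ℂ T

end Operators

/-- The generalized derivation `ρ(U) = A U - U B` on the space of bounded operators `Y → X`. -/
noncomputable def genDerivation {X Y : Type*} [NormedAddCommGroup X] [NormedSpace ℂ X]
    [NormedAddCommGroup Y] [NormedSpace ℂ Y] (A : X →L[ℂ] X) (B : Y →L[ℂ] Y) :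
    (Y →L[ℂ] X) →L[ℂ] (Y →L[ℂ] X) :=
  ContinuousLinearMap.postcomp Y A - ContinuousLinearMap.precomp X B

end WeylBrowder

/-! Write `ρ` for the generalized derivation `U ↦ A U - U B`, and call an operator polaroid if the
isolated points of its spectrum are poles. For a polaroid operator the isolated eigenvalues are
exactly the poles (`IsPolaroid.isoEigenvalues_eq_poles`), so that each Weyl type theorem says the
same as the corresponding Browder type theorem. The equivalence therefore rests on three facts.

*Browder's theorem and its generalized form are equivalent for every operator*
(`browderTheorem_iff_generalizedBrowderTheorem`). The key is the alternative `IsBWeyl.dichotomy`: if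
`T` is B-Weyl, then either all `T - w` with small `w ≠ 0` are Weyl and not invertible, or they are
all invertible and the ascent and the descent of `T` are finite. A Weyl operator is a finite rank
perturbation of an invertible one, and `T - w` is invertible exactly when a determinant, analytic
in `w`, does not vanish; the alternative is that of the isolated zeros of an analytic function.

*The operator `ρ` is polaroid* (`isPolaroid_genDerivation`). An isoloid operator with generalized
Weyl's theorem is polaroid, by the same alternative (`IsIsoloid.isPolaroid`), so `A` is polaroid,
and `B` is polaroid because `B*` is. The spectrum of `ρ` contains `σ(A) - σ(B)`
(`sub_mem_spectrum_genDerivation`): hence if `z` is isolated in `σ(ρ)`, then there are finitely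
many `μ ∈ σ(A)` with `μ - z ∈ σ(B)`, and for these both `μ` and `μ - z` are isolated, so they are
poles. Being a pole means that `T - z` is Drazin invertible, a property of elements of a ring, and
Drazin invertibility of the `A - μ` and `B - (μ - z)` yields that of `ρ - z`: an idempotent for
`ρ - z` is assembled from those of `A - μ` and `B - (μ - z)`, and its properties are checked on the
characters of a commutative Banach algebra (`IsDrazinInvertible.sub_of_commute`).

*Everything passes to the adjoint*: `T*` is Weyl if and only if `T` is (`isWeyl_adjoint_iff`), and
has the same spectrum and the same poles (`hasStablePowers_adjoint_iff`). -/

namespace WeylBrowder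

open Filter Topology

/-! ### Ascent, descent and restriction to an invariant subspace -/

section Algebra

variable {V : Type*} [AddCommGroup V] [Module ℂ V]

/-- Both chains `N(Tⁿ)` and `R(Tⁿ)` are stationary at a common `n`; by `ascent_eq_descent_iff` this
says that the ascent and the descent of `T` are finite and equal. -/
def HasStablePowers (T : V →ₗ[ℂ] V) : Prop :=
  ∃ n : ℕ, (T ^ n).ker = (T ^ (n + 1)).ker ∧ (T ^ n).range = (T ^ (n + 1)).range

theorem ker_pow_add_eq {T : V →ₗ[ℂ] V} {n : ℕ} (h : (T ^ n).ker = (T ^ (n + 1)).ker) (m : ℕ) :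
    (T ^ (n + m)).ker = (T ^ n).ker :=
  (Module.End.ker_pow_constant (f := T) h m).symm

theorem range_pow_add_eq {T : V →ₗ[ℂ] V} {n : ℕ} (h : (T ^ n).range = (T ^ (n + 1)).range)
    (m : ℕ) : (T ^ (n + m)).range = (T ^ n).range := by
  induction m with
  | zero => rfl
  | succ m ih =>
    rw [h, ← add_assoc, pow_succ' T (n + m), pow_succ' T n, Module.End.mul_eq_comp,
      Module.End.mul_eq_comp, LinearMap.range_comp, LinearMap.range_comp, ih]

/-- If the ascent is finite, it is at most the descent. -/
theorem ker_pow_eq_of_range_pow_eq {T : V →ₗ[ℂ] V} {p q : ℕ}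
    (hp : (T ^ p).ker = (T ^ (p + 1)).ker) (hq : (T ^ q).range = (T ^ (q + 1)).range) :
    (T ^ q).ker = (T ^ (q + 1)).ker := by
  refine le_antisymm (fun x hx => ?_) (fun x hx => ?_)
  · rw [LinearMap.mem_ker] at hx ⊢
    rw [pow_succ', Module.End.mul_apply, hx, map_zero]
  · rw [LinearMap.mem_ker] at hx ⊢
    have h1 : (T ^ q) x ∈ (T ^ (q + p)).range := by
      rw [range_pow_add_eq hq]; exact ⟨x, rfl⟩
    obtain ⟨z, hz⟩ := h1
    have h2 : z ∈ (T ^ (p + (q + 1))).ker := by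
      rw [LinearMap.mem_ker, show p + (q + 1) = 1 + (q + p) by ring, pow_add, Module.End.mul_apply,
        hz, pow_one, ← Module.End.mul_apply, ← pow_succ', hx]
    rw [ker_pow_add_eq hp, ← ker_pow_add_eq hp q, LinearMap.mem_ker, add_comm p q, hz] at h2
    exact h2

/-- If the descent is finite, it is at most the ascent. -/
theorem range_pow_eq_of_ker_pow_eq {T : V →ₗ[ℂ] V} {p q : ℕ}
    (hp : (T ^ p).ker = (T ^ (p + 1)).ker) (hq : (T ^ q).range = (T ^ (q + 1)).range) :
    (T ^ p).range = (T ^ (p + 1)).range := by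
  refine le_antisymm ?_ ?_
  · rintro _ ⟨x, rfl⟩
    have h1 : (T ^ (q + p)) x ∈ (T ^ (q + (p + p + 1))).range := by
      rw [range_pow_add_eq hq, ← range_pow_add_eq hq p]; exact ⟨x, rfl⟩
    obtain ⟨z, hz⟩ := h1
    have h2 : x - (T ^ (p + 1)) z ∈ (T ^ (p + q)).ker := by
      rw [LinearMap.mem_ker, map_sub, ← Module.End.mul_apply, ← pow_add, sub_eq_zero, add_comm p q,
        ← hz]
      congr 2; ring
    rw [ker_pow_add_eq hp, LinearMap.mem_ker, map_sub, sub_eq_zero] at h2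
    exact ⟨(T ^ p) z, by
      rw [h2, ← Module.End.mul_apply, ← Module.End.mul_apply, ← pow_add, ← pow_add,
        add_comm p (p + 1)]⟩
  · rw [pow_succ, Module.End.mul_eq_comp]
    exact LinearMap.range_comp_le_range _ _

theorem hasStablePowers_of_ker_of_range {T : V →ₗ[ℂ] V} {p q : ℕ}
    (hp : (T ^ p).ker = (T ^ (p + 1)).ker) (hq : (T ^ q).range = (T ^ (q + 1)).range) :
    HasStablePowers T :=
  ⟨p, hp, range_pow_eq_of_ker_pow_eq hp hq⟩

theorem iInf_natCast_of_exists {P : ℕ → Prop} (h : ∃ n, P n) :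
    (⨅ (n : ℕ) (_ : P n), (n : ℕ∞)) = (sInf {n | P n} : ℕ) :=
  le_antisymm (iInf₂_le _ (Nat.sInf_mem (s := {n | P n}) h))
    (le_iInf₂ fun _ hn => Nat.cast_le.2 (Nat.sInf_le hn))

theorem exists_of_iInf_natCast_lt_top {P : ℕ → Prop}
    (h : (⨅ (n : ℕ) (_ : P n), (n : ℕ∞)) < ⊤) : ∃ n, P n := by
  by_contra! hP
  simp [hP] at h

theorem ascent_eq_descent_iff (T : V →ₗ[ℂ] V) :
    (ascent T = descent T ∧ ascent T < ⊤) ↔ HasStablePowers T := by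
  constructor
  · rintro ⟨h, ht⟩
    obtain ⟨p, hp⟩ := exists_of_iInf_natCast_lt_top ht
    obtain ⟨q, hq⟩ := exists_of_iInf_natCast_lt_top (h ▸ ht : descent T < ⊤)
    exact hasStablePowers_of_ker_of_range hp hq
  · rintro ⟨n, hk, hr⟩
    have hP : {n : ℕ | (T ^ n).ker = (T ^ (n + 1)).ker} =
        {n : ℕ | (T ^ n).range = (T ^ (n + 1)).range} :=
      Set.ext fun m => ⟨fun hm => range_pow_eq_of_ker_pow_eq hm hr,
        fun hm => ker_pow_eq_of_range_pow_eq hk hm⟩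
    have ha : ascent T = (sInf {n : ℕ | (T ^ n).ker = (T ^ (n + 1)).ker} : ℕ) :=
      iInf_natCast_of_exists ⟨n, hk⟩
    have hd : descent T = (sInf {n : ℕ | (T ^ n).range = (T ^ (n + 1)).range} : ℕ) :=
      iInf_natCast_of_exists ⟨n, hr⟩
    rw [ha, hd, hP]
    exact ⟨rfl, ENat.natCast_lt_top _⟩

theorem restrictRangePow_pow_apply (T : V →ₗ[ℂ] V) (n k : ℕ) (x : (T ^ n).range) :
    ((restrictRangePow T n ^ k) x : V) = (T ^ k) x := by
  induction k with
  | zero => rfl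
  | succ k ih =>
    rw [pow_succ', pow_succ', Module.End.mul_apply, Module.End.mul_apply, ← ih]
    rfl

/-- If `T_n` has finite ascent and descent, so has `T`. -/
theorem HasStablePowers.of_restrictRangePow {T : V →ₗ[ℂ] V} {n : ℕ}
    (h : HasStablePowers (restrictRangePow T n)) : HasStablePowers T := by
  obtain ⟨p, hk, hr⟩ := h
  refine ⟨p + n, ?_, ?_⟩
  · ext x
    have := Submodule.ext_iff.1 hk ⟨(T ^ n) x, x, rfl⟩
    simp only [LinearMap.mem_ker, ← Subtype.coe_inj, restrictRangePow_pow_apply,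
      ZeroMemClass.coe_zero] at this
    rw [LinearMap.mem_ker, LinearMap.mem_ker, show p + n + 1 = (p + 1) + n by ring, pow_add T p,
      pow_add T (p + 1), Module.End.mul_apply, Module.End.mul_apply, this]
  -- `R(T_n ^ k)` is `R(T ^ (k + n))`
  · have key : ∀ k y, y ∈ (T ^ (k + n)).range ↔
        ∃ z ∈ (restrictRangePow T n ^ k).range, (z : V) = y := by
      intro k y
      constructor
      · rintro ⟨x, rfl⟩
        refine ⟨_, ⟨⟨(T ^ n) x, x, rfl⟩, rfl⟩, ?_⟩
        rw [restrictRangePow_pow_apply, pow_add, Module.End.mul_apply]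
      · rintro ⟨_, ⟨⟨_, x, rfl⟩, rfl⟩, rfl⟩
        rw [restrictRangePow_pow_apply, ← Module.End.mul_apply, ← pow_add]
        exact ⟨x, rfl⟩
    ext y
    rw [show p + n + 1 = (p + 1) + n by ring, key, key, hr]

/-- The decomposition at a pole: for some `n`, the space is the direct sum of `R(Tⁿ)`, on which `T`
is bijective, and of `N(Tⁿ)`, on which it is nilpotent. -/
theorem HasStablePowers.exists_bijective_restrictRangePow {T : V →ₗ[ℂ] V}
    (h : HasStablePowers T) : ∃ n, Function.Bijective (restrictRangePow T n) ∧
      IsCompl (T ^ n).range (T ^ n).ker := by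
  obtain ⟨n, hk, hr⟩ := h
  have h2 : (T ^ n).ker = (T ^ (n + n)).ker := (ker_pow_add_eq hk n).symm
  have h3 : (T ^ n).range = (T ^ (n + n)).range := (range_pow_add_eq hr n).symm
  refine ⟨n, ⟨?_, ?_⟩, ?_⟩
  · rw [← LinearMap.ker_eq_bot, LinearMap.ker_eq_bot']
    rintro ⟨_, x, rfl⟩ hx
    have hx' : T ((T ^ n) x) = 0 := congrArg Subtype.val hx
    rw [← Module.End.mul_apply, ← pow_succ', ← LinearMap.mem_ker, ← hk, LinearMap.mem_ker] at hx'
    exact Subtype.ext hx'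
  · rintro ⟨y, hy⟩
    have hy' := hy
    rw [hr] at hy'
    obtain ⟨x, hx⟩ := hy'
    rw [pow_succ', Module.End.mul_apply] at hx
    exact ⟨⟨(T ^ n) x, x, rfl⟩, Subtype.ext hx⟩
  · refine IsCompl.of_eq ?_ ?_
    · rw [Submodule.eq_bot_iff]
      rintro _ ⟨⟨x, rfl⟩, hx⟩
      rw [SetLike.mem_coe, LinearMap.mem_ker, ← Module.End.mul_apply, ← pow_add,
        ← LinearMap.mem_ker, ← h2, LinearMap.mem_ker] at hx
      exact hx
    · rw [eq_top_iff]
      intro x _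
      have hx : (T ^ n) x ∈ (T ^ (n + n)).range := h3 ▸ ⟨x, rfl⟩
      obtain ⟨z, hz⟩ := hx
      rw [Submodule.mem_sup]
      refine ⟨(T ^ n) z, ⟨z, rfl⟩, x - (T ^ n) z, ?_, by abel⟩
      rw [LinearMap.mem_ker, map_sub, ← Module.End.mul_apply, ← pow_add, hz, sub_self]

/-! ### Weyl operators under restriction and finite rank perturbation -/

section Restrict

variable {T : V →ₗ[ℂ] V} {W : Submodule ℂ V} (hW : ∀ x ∈ W, T x ∈ W)
  (hpre : ∀ x, T x ∈ W → x ∈ W) (hsup : ∀ x, ∃ y, x - T y ∈ W)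

include hpre

/-- If `T⁻¹(W) ⊆ W`, then `T` and its restriction to `W` have the same null space. -/
noncomputable def kerRestrictEquiv : (T.restrict hW).ker ≃ₗ[ℂ] T.ker :=
  LinearEquiv.ofBijective
    (LinearMap.codRestrict T.ker (W.subtype ∘ₗ (T.restrict hW).ker.subtype)
      fun x => congrArg Subtype.val x.2)
    ⟨fun _ _ h => Subtype.ext (Subtype.ext (congrArg (Subtype.val : T.ker → V) h)), fun x =>
      ⟨⟨⟨x.1, hpre x.1 (by rw [LinearMap.mem_ker.1 x.2]; exact W.zero_mem)⟩,
        Subtype.ext x.2⟩, rfl⟩⟩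

include hsup

/-- If `T⁻¹(W) ⊆ W` and `W + R(T)` is everything, then `T` and its restriction to `W` have the same
cokernel. -/
noncomputable def cokerRestrictEquiv : (W ⧸ (T.restrict hW).range) ≃ₗ[ℂ] (V ⧸ T.range) :=
  LinearEquiv.ofBijective
    (Submodule.mapQ (T.restrict hW).range T.range W.subtype (by
      rintro _ ⟨x, rfl⟩; exact ⟨x, rfl⟩))
    ⟨by
      rw [← LinearMap.ker_eq_bot, LinearMap.ker_eq_bot']
      intro q
      induction q using Submodule.Quotient.induction_on with
      | H w =>
        intro h
        rw [Submodule.mapQ_apply, Submodule.Quotient.mk_eq_zero] at h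
        obtain ⟨x, hx⟩ := h
        rw [Submodule.Quotient.mk_eq_zero]
        exact ⟨⟨x, hpre x (hx ▸ w.2)⟩, Subtype.ext hx⟩, by
      intro q
      induction q using Submodule.Quotient.induction_on with
      | H x =>
        obtain ⟨y, hy⟩ := hsup x
        refine ⟨Submodule.Quotient.mk ⟨x - T y, hy⟩, ?_⟩
        rw [Submodule.mapQ_apply, Submodule.Quotient.eq]
        exact ⟨-y, by simp⟩⟩

theorem isWeyl_restrict_iff : IsWeyl (T.restrict hW) ↔ IsWeyl T := by
  have e := kerRestrictEquiv hW hpre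
  have f := cokerRestrictEquiv hW hpre hsup
  unfold IsWeyl IsFredholm index
  rw [e.finrank_eq, f.finrank_eq]
  exact and_congr_left' (and_congr ⟨fun _ => e.finiteDimensional, fun _ => e.symm.finiteDimensional⟩
    ⟨fun _ => f.finiteDimensional, fun _ => f.symm.finiteDimensional⟩)

theorem bijective_restrict_iff : Function.Bijective (T.restrict hW) ↔ Function.Bijective T := by
  constructor
  · rintro ⟨hi, hs⟩
    constructor
    · rw [← LinearMap.ker_eq_bot, LinearMap.ker_eq_bot']
      intro x hx
      have hxW : x ∈ W := hpre x (hx ▸ W.zero_mem)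
      have : (⟨x, hxW⟩ : W) = 0 := hi (by rw [map_zero]; exact Subtype.ext hx)
      exact congrArg Subtype.val this
    · intro x
      obtain ⟨y, hy⟩ := hsup x
      obtain ⟨w, hw⟩ := hs ⟨_, hy⟩
      refine ⟨w + y, ?_⟩
      have : T w = x - T y := congrArg Subtype.val hw
      rw [map_add, this, sub_add_cancel]
  · rintro ⟨hi, hs⟩
    constructor
    · intro x y h
      exact Subtype.ext (hi (congrArg Subtype.val h))
    · rintro ⟨w, hw⟩
      obtain ⟨x, rfl⟩ := hs w
      exact ⟨⟨x, hpre x hw⟩, rfl⟩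

end Restrict

theorem isWeyl_of_finiteDimensional [FiniteDimensional ℂ V] (T : V →ₗ[ℂ] V) : IsWeyl T := by
  refine ⟨⟨inferInstance, inferInstance⟩, ?_⟩
  have h1 := T.finrank_range_add_finrank_ker
  have h2 := T.range.finrank_quotient_add_finrank
  unfold index
  omega

/-- The operator `1 + F` restricts to the finite dimensional space `R(F)`, with the same null space
and cokernel. -/
theorem isWeyl_id_add (F : V →ₗ[ℂ] V) [FiniteDimensional ℂ F.range] :
    IsWeyl (LinearMap.id + F) := by
  have hW : ∀ x ∈ F.range, (LinearMap.id + F : V →ₗ[ℂ] V) x ∈ F.range := fun x hx =>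
    F.range.add_mem hx ⟨x, rfl⟩
  rw [← isWeyl_restrict_iff hW]
  · exact isWeyl_of_finiteDimensional _
  · intro x hx
    have := F.range.sub_mem hx ⟨x, rfl⟩
    simpa using this
  · exact fun x => ⟨x, -x, by simp⟩

/-- A finite rank perturbation of a bijective operator is a Weyl operator. -/
theorem isWeyl_of_bijective_of_finiteDimensional {T G : V →ₗ[ℂ] V} (hG : Function.Bijective G)
    (hF : FiniteDimensional ℂ (T - G).range) : IsWeyl T := by
  let e := LinearEquiv.ofBijective G hG
  have hT : T = (e : V →ₗ[ℂ] V) ∘ₗ (LinearMap.id + (e.symm : V →ₗ[ℂ] V) ∘ₗ (T - G)) := by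
    ext x
    simp only [LinearMap.comp_apply, LinearMap.add_apply, LinearMap.id_apply, map_add,
      LinearEquiv.coe_coe, LinearEquiv.apply_symm_apply, LinearMap.sub_apply]
    simp [e]
  have hfin : FiniteDimensional ℂ ((e.symm : V →ₗ[ℂ] V) ∘ₗ (T - G)).range := by
    rw [LinearMap.range_comp]
    infer_instance
  obtain ⟨⟨h1, h2⟩, h3⟩ := isWeyl_id_add ((e.symm : V →ₗ[ℂ] V) ∘ₗ (T - G))
  set S := LinearMap.id + (e.symm : V →ₗ[ℂ] V) ∘ₗ (T - G) with hS
  have hker : T.ker = S.ker := by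
    rw [hT, LinearEquiv.ker_comp]
  have f : (V ⧸ S.range) ≃ₗ[ℂ] (V ⧸ T.range) :=
    Submodule.Quotient.equiv _ _ e (by rw [hT, LinearMap.range_comp])
  unfold IsWeyl IsFredholm index at *
  rw [hker, ← f.finrank_eq]
  exact ⟨⟨h1, f.finiteDimensional⟩, h3⟩

theorem finiteDimensional_range_pow_sub_pow {T G : V →ₗ[ℂ] V}
    (hF : FiniteDimensional ℂ (T - G).range) (k : ℕ) :
    FiniteDimensional ℂ (T ^ k - G ^ k).range := by
  induction k with
  | zero =>
    rw [pow_zero, pow_zero, sub_self, LinearMap.range_zero]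
    infer_instance
  | succ k ih =>
    have : T ^ (k + 1) - G ^ (k + 1) = T ∘ₗ (T ^ k - G ^ k) + (T - G) ∘ₗ G ^ k := by
      ext x
      simp [pow_succ']
    have h1 : FiniteDimensional ℂ (T ∘ₗ (T ^ k - G ^ k)).range := by
      rw [LinearMap.range_comp]; infer_instance
    have h2 : FiniteDimensional ℂ ((T - G) ∘ₗ G ^ k).range :=
      Submodule.finiteDimensional_of_le (LinearMap.range_comp_le_range _ _)
    rw [this]
    refine Submodule.finiteDimensional_of_le
      (S₂ := (T ∘ₗ (T ^ k - G ^ k)).range ⊔ ((T - G) ∘ₗ G ^ k).range) ?_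
    rintro _ ⟨x, rfl⟩
    exact Submodule.add_mem_sup ⟨x, rfl⟩ ⟨x, rfl⟩

/-- For a finite rank perturbation of a bijective operator, finite ascent implies finite descent:
the powers are again of this kind, so that null spaces and cokernels have the same dimension. -/
theorem hasStablePowers_of_ker_pow_eq {T G : V →ₗ[ℂ] V} (hG : Function.Bijective G)
    (hF : FiniteDimensional ℂ (T - G).range) {p : ℕ} (hp : (T ^ p).ker = (T ^ (p + 1)).ker) :
    HasStablePowers T := by
  have hW : ∀ k, IsWeyl (T ^ k) := fun k => by
    refine isWeyl_of_bijective_of_finiteDimensional (G := G ^ k) ?_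
      (finiteDimensional_range_pow_sub_pow hF k)
    rw [Module.End.coe_pow]
    exact hG.iterate k
  refine ⟨p, hp, ?_⟩
  have hle : (T ^ (p + 1)).range ≤ (T ^ p).range := by
    rw [pow_succ, Module.End.mul_eq_comp]
    exact LinearMap.range_comp_le_range _ _
  have h1 := (hW p).2
  have h2 := (hW (p + 1)).2
  have : FiniteDimensional ℂ (V ⧸ (T ^ (p + 1)).range) := (hW (p + 1)).1.2
  have : FiniteDimensional ℂ (V ⧸ (T ^ p).range) := (hW p).1.2
  unfold index at h1 h2
  rw [hp] at h1
  have hinj : Function.Injective (Submodule.factor hle) :=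
    (LinearMap.injective_iff_surjective_of_finrank_eq_finrank (by omega)).2
      (Submodule.factor_surjective hle)
  refine le_antisymm (fun x hx => ?_) hle
  rw [← Submodule.Quotient.mk_eq_zero]
  apply hinj
  rw [map_zero]
  exact (Submodule.Quotient.mk_eq_zero _).2 hx

end Algebra

/-! ### Closed ranges and splittings of Weyl operators -/

section ClosedRange

variable {E F : Type*} [NormedAddCommGroup E] [NormedSpace ℂ E] [CompleteSpace E]
  [NormedAddCommGroup F] [NormedSpace ℂ F] [CompleteSpace F]

/-- A bounded operator whose range has a closed algebraic complement has closed range. -/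
theorem isClosed_range_of_isCompl (S : E →L[ℂ] F) {C : Submodule ℂ F}
    (hC : IsClosed (C : Set F)) (h : IsCompl (S : E →ₗ[ℂ] F).range C) :
    IsClosed ((S : E →ₗ[ℂ] F).range : Set F) := by
  have : CompleteSpace C := hC.completeSpace_coe
  -- The range pulls back to `E × {0}` along the open map `(x, c) ↦ S x + c`.
  have hsurj : Function.Surjective (S.coprod C.subtypeL) := by
    intro y
    obtain ⟨_, ⟨x, rfl⟩, c, hc, hy⟩ :=
      Submodule.mem_sup.1 (h.sup_eq_top ▸ Submodule.mem_top (x := y))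
    exact ⟨(x, ⟨c, hc⟩), by simpa using hy⟩
  rw [← ((S.coprod C.subtypeL).isQuotientMap hsurj).isClosed_preimage]
  have : S.coprod C.subtypeL ⁻¹' ((S : E →ₗ[ℂ] F).range : Set F) = {p | p.2 = 0} := by
    ext ⟨x, c⟩
    simp only [Set.mem_preimage, ContinuousLinearMap.coprod_apply, Submodule.subtypeL_apply,
      SetLike.mem_coe, Set.mem_ofPred_eq]
    constructor
    · intro hx
      have hc : (c : F) ∈ (S : E →ₗ[ℂ] F).range := by
        have := Submodule.sub_mem _ hx ⟨x, rfl⟩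
        simpa using this
      exact Subtype.ext (Submodule.disjoint_def.1 h.disjoint _ hc c.2)
    · rintro rfl
      exact ⟨x, by simp⟩
  rw [this]
  exact isClosed_eq continuous_snd continuous_const

theorem isClosed_range_of_finiteDimensional_coker (S : E →L[ℂ] F)
    (h : FiniteDimensional ℂ (F ⧸ (S : E →ₗ[ℂ] F).range)) :
    IsClosed ((S : E →ₗ[ℂ] F).range : Set F) := by
  obtain ⟨C, hC⟩ := (S : E →ₗ[ℂ] F).range.exists_isCompl
  have : FiniteDimensional ℂ C :=
    (Submodule.quotientEquivOfIsCompl _ _ hC).finiteDimensional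
  exact isClosed_range_of_isCompl S C.closed_of_finiteDimensional hC

omit [CompleteSpace E] in
/-- A Weyl operator becomes invertible after adding an operator which factors through `ℂᵈ`. -/
theorem IsWeyl.exists_bijective_add {S : E →L[ℂ] E} (hS : IsWeyl (S : E →ₗ[ℂ] E)) :
    ∃ (d : ℕ) (π : E →L[ℂ] (Fin d → ℂ)) (ι : (Fin d → ℂ) →L[ℂ] E),
      Function.Bijective (S + ι.comp π) := by
  obtain ⟨⟨hk, hc⟩, hi⟩ := hS
  obtain ⟨P, hP⟩ := Submodule.ClosedComplemented.of_finiteDimensional (𝕜 := ℂ)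
    (S : E →ₗ[ℂ] E).ker
  obtain ⟨C, hC⟩ := (S : E →ₗ[ℂ] E).range.exists_isCompl
  let q := Submodule.quotientEquivOfIsCompl _ _ hC
  have hCfin : FiniteDimensional ℂ C := q.finiteDimensional
  have hd : Module.finrank ℂ (S : E →ₗ[ℂ] E).ker = Module.finrank ℂ C := by
    rw [← q.finrank_eq]
    unfold index at hi
    omega
  let b := (Module.finBasis ℂ (S : E →ₗ[ℂ] E).ker).equivFun
  -- Index zero identifies `N(S)` with a complement `C` of `R(S)`; the sum is `S + J P`, where `P` is
  -- a bounded projection onto `N(S)`.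
  let J := LinearEquiv.ofFinrankEq _ _ hd
  let ι₀ : (Fin (Module.finrank ℂ (S : E →ₗ[ℂ] E).ker) → ℂ) →ₗ[ℂ] E :=
    C.subtype ∘ₗ (b.symm.trans J : _ →ₗ[ℂ] C)
  have key : ∀ x, (S + (LinearMap.toContinuousLinearMap ι₀).comp
      ((LinearMap.toContinuousLinearMap (b : _ →ₗ[ℂ] _)).comp P)) x = S x + J (P x) := by
    intro x
    simp [ι₀]
  refine ⟨_, (LinearMap.toContinuousLinearMap (b : _ →ₗ[ℂ] _)).comp P,
    LinearMap.toContinuousLinearMap ι₀, ?_, ?_⟩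
  · rw [injective_iff_map_eq_zero]
    intro x hx
    rw [key] at hx
    have h1 : S x ∈ C := by
      rw [eq_neg_of_add_eq_zero_left hx]
      exact C.neg_mem (J (P x)).2
    have h2 : S x = 0 := Submodule.disjoint_def.1 hC.disjoint _ ⟨x, rfl⟩ h1
    rw [h2, zero_add, ZeroMemClass.coe_eq_zero, LinearEquiv.map_eq_zero_iff] at hx
    have := hP ⟨x, h2⟩
    rw [hx] at this
    exact (congrArg Subtype.val this).symm
  · intro y
    obtain ⟨_, ⟨x, rfl⟩, c, hc, rfl⟩ :=
      Submodule.mem_sup.1 (hC.sup_eq_top ▸ Submodule.mem_top (x := y))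
    refine ⟨x - P x + J.symm ⟨c, hc⟩, ?_⟩
    have h1 : S (P x : E) = 0 := (P x).2
    have h2 : S (J.symm ⟨c, hc⟩ : E) = 0 := (J.symm ⟨c, hc⟩).2
    rw [key, map_add, map_sub, h1, h2, map_add, map_sub, hP, hP]
    simp

end ClosedRange

/-! ### Perturbation of Weyl and B-Weyl operators by small scalars -/

section Dichotomy

variable {E : Type*} [NormedAddCommGroup E] [NormedSpace ℂ E]

theorem shift_apply (T : E →L[ℂ] E) (z : ℂ) (x : E) : shift T z x = T x - z • x := rfl

theorem shift_zero (T : E →L[ℂ] E) : shift T 0 = T := by simp [shift]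

theorem shift_shift (T : E →L[ℂ] E) (z w : ℂ) : shift (shift T z) w = shift T (z + w) := by
  simp [shift, add_smul, sub_sub]

theorem continuous_shift (T : E →L[ℂ] E) : Continuous (shift T) := by
  unfold shift; fun_prop

variable [CompleteSpace E]

theorem mem_spectrum_iff (T : E →L[ℂ] E) (z : ℂ) :
    z ∈ spectrum ℂ T ↔ ¬ Function.Bijective (shift T z) := by
  rw [← ContinuousLinearMap.isUnit_iff_bijective, spectrum.mem_iff, ← IsUnit.neg_iff, neg_sub]
  rfl

theorem eventually_bijective_shift {T : E →L[ℂ] E} (hT : Function.Bijective T) :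
    ∀ᶠ z in 𝓝 (0 : ℂ), Function.Bijective (shift T z) := by
  simp_rw [← ContinuousLinearMap.isUnit_iff_bijective]
  refine (continuous_shift T).continuousAt.eventually_mem (Units.isOpen.mem_nhds ?_)
  rw [shift_zero]
  exact ContinuousLinearMap.isUnit_iff_bijective.2 hT

section Determinant

variable {d : ℕ} (G : E →L[ℂ] E) (π : E →L[ℂ] (Fin d → ℂ)) (ι : (Fin d → ℂ) →L[ℂ] E)

/-- The matrix of `1 - π (G - z)⁻¹ ι`, whose determinant detects the invertibility of
`G - ι π - z` when `G - z` is invertible. -/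
noncomputable def perturbationMatrix (z : ℂ) : Matrix (Fin d) (Fin d) ℂ :=
  1 - LinearMap.toMatrix' (π.comp ((Ring.inverse (shift G z)).comp ι) : (Fin d → ℂ) →ₗ[ℂ] _)

omit [CompleteSpace E] in
theorem perturbationMatrix_mulVec (z : ℂ) (v : Fin d → ℂ) :
    (perturbationMatrix G π ι z).mulVec v = v - π (Ring.inverse (shift G z) (ι v)) := by
  rw [perturbationMatrix, Matrix.sub_mulVec, Matrix.one_mulVec, LinearMap.toMatrix'_mulVec]
  rfl

variable {G} in
theorem analyticAt_inverse_shift (hG : Function.Bijective G) :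
    AnalyticAt ℂ (fun z => Ring.inverse (shift G z)) 0 := by
  obtain ⟨u, hu⟩ := ContinuousLinearMap.isUnit_iff_bijective.2 hG
  have h1 : AnalyticAt ℂ (Ring.inverse : (E →L[ℂ] E) → _) (shift G 0) := by
    rw [shift_zero, ← hu]
    exact analyticAt_inverse u
  have h2 : AnalyticAt ℂ (shift G) 0 :=
    analyticAt_const.sub (analyticAt_id.smul analyticAt_const)
  exact h1.comp h2

variable {G} in
theorem analyticAt_perturbationMatrix (hG : Function.Bijective G) (i j : Fin d) :
    AnalyticAt ℂ (fun z => perturbationMatrix G π ι z i j) 0 := by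
  let L : (E →L[ℂ] E) →L[ℂ] ℂ :=
    (ContinuousLinearMap.proj (R := ℂ) (φ := fun _ : Fin d => ℂ) i).comp
    (π.comp (ContinuousLinearMap.apply ℂ E (ι (Pi.single j 1))))
  have h2 : AnalyticAt ℂ (fun z => L (Ring.inverse (shift G z))) 0 :=
    (L.analyticAt _).comp (analyticAt_inverse_shift hG)
  have h3 := (analyticAt_const (v := (1 : Matrix (Fin d) (Fin d) ℂ) i j)).sub h2
  refine h3.congr (Eventually.of_forall fun z => ?_)
  simp only [perturbationMatrix, Pi.sub_apply, Matrix.sub_apply, LinearMap.toMatrix'_apply]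
  rfl

variable {G} in
theorem analyticAt_det_perturbationMatrix (hG : Function.Bijective G) :
    AnalyticAt ℂ (fun z => (perturbationMatrix G π ι z).det) 0 := by
  simp_rw [Matrix.det_apply']
  exact Finset.analyticAt_fun_sum _ fun σ _ => analyticAt_const.mul
    (Finset.analyticAt_fun_prod _ fun i _ => analyticAt_perturbationMatrix π ι hG _ _)

variable {G π ι} in
/-- If `x` is a null vector of `G - ι π - z`, then `π x` is a null vector of the matrix; conversely
`v` yields `(G - z)⁻¹ ι v`. -/
theorem injective_shift_iff_det_ne_zero {z : ℂ} (hz : Function.Bijective (shift G z)) :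
    Function.Injective (shift (G - ι.comp π) z) ↔ (perturbationMatrix G π ι z).det ≠ 0 := by
  have hu := ContinuousLinearMap.isUnit_iff_bijective.2 hz
  have hl : ∀ x, Ring.inverse (shift G z) (shift G z x) = x := fun x =>
    congrArg (fun f : E →L[ℂ] E => f x) (Ring.inverse_mul_cancel _ hu)
  have hr : ∀ x, shift G z (Ring.inverse (shift G z) x) = x := fun x =>
    congrArg (fun f : E →L[ℂ] E => f x) (Ring.mul_inverse_cancel _ hu)
  have hS : ∀ x, shift (G - ι.comp π) z x = shift G z x - ι (π x) := fun x => by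
    simp only [shift_apply, sub_apply, ContinuousLinearMap.comp_apply]
    abel
  rw [Ne, ← Matrix.exists_mulVec_eq_zero_iff, injective_iff_map_eq_zero]
  push Not
  constructor
  · intro h v hv hv0
    rw [perturbationMatrix_mulVec, sub_eq_zero] at hv0
    have := h (Ring.inverse (shift G z) (ι v)) (by rw [hS, hr, ← hv0, sub_self])
    rw [this, map_zero] at hv0
    exact hv hv0
  · intro h x hx
    rw [hS, sub_eq_zero] at hx
    have hx' : x = Ring.inverse (shift G z) (ι (π x)) := by rw [← hx, hl]
    by_contra hne
    refine h (π x) (fun h0 => hne ?_) ?_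
    · rw [hx', h0, map_zero, map_zero]
    · rw [perturbationMatrix_mulVec, ← hx', sub_self]

variable {G π ι} in
/-- If `det (1 - π (G - z)⁻¹ ι)` vanishes at `0` to the finite order `m`, then the ascent of
`G - ι π` is at most `m`: a Jordan chain of length `m + 1` would give an analytic
`u` with `u(0) ≠ 0` and `(G - ι π - z) u(z) = O(z ^ (m + 1))`. -/
theorem exists_ker_pow_eq (hG : Function.Bijective G)
    (hdet : ¬ ∀ᶠ z in 𝓝 (0 : ℂ), (perturbationMatrix G π ι z).det = 0) :
    ∃ m : ℕ, (((G - ι.comp π : E →L[ℂ] E) : E →ₗ[ℂ] E) ^ m).ker =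
      (((G - ι.comp π : E →L[ℂ] E) : E →ₗ[ℂ] E) ^ (m + 1)).ker := by
  obtain ⟨m, g, hg, hg0, hgm⟩ :=
    (analyticAt_det_perturbationMatrix π ι hG).exists_eventuallyEq_pow_smul_nonzero_iff.2 hdet
  set S := G - ι.comp π with hSdef
  refine ⟨m, le_antisymm (fun x hx => ?_) (fun x hx => ?_)⟩
  · rw [LinearMap.mem_ker] at hx ⊢
    rw [pow_succ', Module.End.mul_apply, hx, map_zero]
  rw [LinearMap.mem_ker] at hx ⊢
  set s := (S : E →ₗ[ℂ] E) with hs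
  -- `u z = z ^ m x + z ^ (m - 1) S x + ⋯ + S ^ m x`
  let u : ℂ → E := fun z => ∑ j ∈ Finset.range (m + 1), z ^ (m - j) • (s ^ j) x
  have hu0 : u 0 = (s ^ m) x := by
    simp only [u]
    rw [Finset.sum_range_succ, Finset.sum_eq_zero, zero_add, Nat.sub_self, pow_zero, one_smul]
    intro j hj
    rw [zero_pow (by have := Finset.mem_range.1 hj; omega), zero_smul]
  have hucont : Continuous u := by fun_prop
  have hSu : ∀ z, shift S z (u z) = -(z ^ (m + 1) • x) := by
    intro z
    have h1 : S (u z) = ∑ j ∈ Finset.range (m + 1), z ^ (m - j) • (s ^ (j + 1)) x := by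
      simp only [u, map_sum, map_smul]
      refine Finset.sum_congr rfl fun j _ => ?_
      rw [pow_succ', Module.End.mul_apply]
      rfl
    have h2 : z • u z = ∑ j ∈ Finset.range (m + 1), z ^ (m + 1 - j) • (s ^ j) x := by
      simp only [u, Finset.smul_sum, smul_smul]
      refine Finset.sum_congr rfl fun j hj => ?_
      rw [← pow_succ', Nat.sub_add_comm (Nat.lt_succ_iff.1 (Finset.mem_range.1 hj))]
    rw [shift_apply, h1, h2, Finset.sum_range_succ, hx, smul_zero, add_zero,
      Finset.sum_range_succ', sub_add_eq_sub_sub]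
    simp
  -- The matrix maps `π (u z)` to a multiple of `z ^ (m + 1)`. Multiply by the adjugate, which gives
  -- the factor `z ^ m g z` on the left, cancel `z ^ m`, and let `z` tend to `0`.
  have hker : ∀ᶠ z in 𝓝[≠] (0 : ℂ), g z • π (u z) =
      -(z • (perturbationMatrix G π ι z).adjugate.mulVec
        (π (Ring.inverse (shift G z) x))) := by
    filter_upwards [(eventually_bijective_shift hG).filter_mono nhdsWithin_le_nhds,
      hgm.filter_mono nhdsWithin_le_nhds, self_mem_nhdsWithin] with z hz hgz hz0
    have hl : ∀ x, Ring.inverse (shift G z) (shift G z x) = x := fun x =>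
      congrArg (fun f : E →L[ℂ] E => f x)
        (Ring.inverse_mul_cancel _ (ContinuousLinearMap.isUnit_iff_bijective.2 hz))
    have h1 : shift G z (u z) = ι (π (u z)) - z ^ (m + 1) • x := by
      rw [sub_eq_add_neg, ← hSu, hSdef]
      simp only [shift_apply, sub_apply, ContinuousLinearMap.comp_apply]
      abel
    have h2 : (perturbationMatrix G π ι z).mulVec (π (u z)) =
        -(z ^ (m + 1) • π (Ring.inverse (shift G z) x)) := by
      rw [perturbationMatrix_mulVec]
      conv_lhs => enter [1]; rw [← hl (u z), h1]
      simp
    have h3 := congrArg (perturbationMatrix G π ι z).adjugate.mulVec h2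
    rw [Matrix.mulVec_mulVec, Matrix.adjugate_mul, Matrix.smul_mulVec, Matrix.one_mulVec, hgz,
      sub_zero, Matrix.mulVec_neg, Matrix.mulVec_smul, smul_assoc, pow_succ, mul_smul,
      ← smul_neg] at h3
    exact smul_right_injective _ (pow_ne_zero m hz0) h3
  have hMcont : ContinuousAt (perturbationMatrix G π ι) 0 := by
    refine continuousAt_pi.2 fun i => continuousAt_pi.2 fun j => ?_
    exact (analyticAt_perturbationMatrix π ι hG i j).continuousAt
  have hadj : ContinuousAt (fun z => (perturbationMatrix G π ι z).adjugate) 0 :=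
    (continuous_id.matrix_adjugate).continuousAt.comp hMcont
  have hHx : ContinuousAt (fun z => π (Ring.inverse (shift G z) x)) 0 :=
    π.continuous.continuousAt.comp
      ((ContinuousLinearMap.apply ℂ E x).continuous.continuousAt.comp
        (analyticAt_inverse_shift hG).continuousAt)
  have hright : ContinuousAt (fun z => -(z • (perturbationMatrix G π ι z).adjugate.mulVec
      (π (Ring.inverse (shift G z) x)))) 0 := by
    have : Continuous (fun p : Matrix (Fin d) (Fin d) ℂ × (Fin d → ℂ) => p.1.mulVec p.2) :=
      continuous_fst.matrix_mulVec continuous_snd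
    exact (continuousAt_id.smul (this.continuousAt.comp (hadj.prodMk hHx))).neg
  have hleft : ContinuousAt (fun z => g z • π (u z)) 0 :=
    hg.continuousAt.smul (π.continuous.continuousAt.comp hucont.continuousAt)
  have hlim := tendsto_nhds_unique_of_eventuallyEq
    (hleft.tendsto.mono_left nhdsWithin_le_nhds) (hright.tendsto.mono_left nhdsWithin_le_nhds) hker
  rw [zero_smul, neg_zero, smul_eq_zero, or_iff_right hg0, hu0] at hlim
  -- Now `π (S ^ m x) = 0`, so that `G` and `S` agree on `S ^ m x`, which `S` annihilates.
  refine (injective_iff_map_eq_zero G).1 hG.1 _ ?_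
  have h4 : S ((s ^ m) x) = 0 := by
    rw [pow_succ', Module.End.mul_apply] at hx
    exact hx
  have h5 : G ((s ^ m) x) = S ((s ^ m) x) + ι (π ((s ^ m) x)) := by simp [hSdef]
  rw [h5, h4, hlim, map_zero, add_zero]

end Determinant

/-- Near `0`, a Weyl operator `S` behaves in one of two ways: either no `S - z` with `z ≠ 0` is
invertible while all of them are Weyl, or all `S - z` with `z ≠ 0` are invertible and `S` has finite
ascent and descent. -/
theorem IsWeyl.dichotomy {S : E →L[ℂ] E} (hS : IsWeyl (S : E →ₗ[ℂ] E)) :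
    (∀ᶠ z in 𝓝[≠] (0 : ℂ), ¬ Function.Bijective (shift S z) ∧
      IsWeyl (shift S z : E →ₗ[ℂ] E)) ∨
    ((∀ᶠ z in 𝓝[≠] (0 : ℂ), Function.Bijective (shift S z)) ∧
      HasStablePowers (S : E →ₗ[ℂ] E)) := by
  obtain ⟨d, π, ι, hG⟩ := hS.exists_bijective_add
  set G := S + ι.comp π with hGdef
  have hSG : S = G - ι.comp π := by rw [hGdef, add_sub_cancel_right]
  have hfin : ∀ z, FiniteDimensional ℂ
      ((shift S z : E →ₗ[ℂ] E) - (shift G z : E →ₗ[ℂ] E)).range := by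
    intro z
    have : (shift S z : E →ₗ[ℂ] E) - (shift G z : E →ₗ[ℂ] E) =
        -((ι : (Fin d → ℂ) →ₗ[ℂ] E) ∘ₗ (π : E →ₗ[ℂ] (Fin d → ℂ))) := by
      ext x
      simp [shift_apply, hGdef]
    rw [this, LinearMap.range_neg]
    exact Submodule.finiteDimensional_of_le (LinearMap.range_comp_le_range _ _)
  have hweyl : ∀ᶠ z in 𝓝[≠] (0 : ℂ), IsWeyl (shift S z : E →ₗ[ℂ] E) := by
    filter_upwards [(eventually_bijective_shift hG).filter_mono nhdsWithin_le_nhds] with z hz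
    exact isWeyl_of_bijective_of_finiteDimensional hz (hfin z)
  have hbij : ∀ᶠ z in 𝓝[≠] (0 : ℂ), (Function.Bijective (shift S z) ↔
      (perturbationMatrix G π ι z).det ≠ 0) := by
    filter_upwards [(eventually_bijective_shift hG).filter_mono nhdsWithin_le_nhds, hweyl]
      with z hz hw
    rw [← injective_shift_iff_det_ne_zero hz, ← hSG]
    refine ⟨fun h => h.1, fun h => ⟨h, ?_⟩⟩
    obtain ⟨⟨h1, h2⟩, h3⟩ := hw
    have hk : (shift S z : E →ₗ[ℂ] E).ker = ⊥ := LinearMap.ker_eq_bot.2 h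
    unfold index at h3
    rw [hk, finrank_bot] at h3
    have h4 : Module.finrank ℂ (E ⧸ (shift S z : E →ₗ[ℂ] E).range) = 0 := by omega
    rw [Module.finrank_zero_iff, Submodule.Quotient.subsingleton_iff] at h4
    exact LinearMap.range_eq_top.1 h4
  rcases (analyticAt_det_perturbationMatrix π ι hG).eventually_eq_zero_or_eventually_ne_zero
    with h0 | h0
  · left
    filter_upwards [hweyl, hbij, h0.filter_mono nhdsWithin_le_nhds] with z h1 h2 h3
    exact ⟨fun h => h2.1 h h3, h1⟩
  · right
    refine ⟨by filter_upwards [hbij, h0] with z h1 h2 using h1.2 h2, ?_⟩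
    have hne : ¬ ∀ᶠ z in 𝓝 (0 : ℂ), (perturbationMatrix G π ι z).det = 0 := fun h =>
      ((h.filter_mono nhdsWithin_le_nhds).and h0).exists.elim fun z hz => hz.2 hz.1
    obtain ⟨m, hm⟩ := exists_ker_pow_eq hG hne
    rw [← hSG] at hm
    have h0 := hfin 0
    rw [shift_zero, shift_zero] at h0
    exact hasStablePowers_of_ker_pow_eq hG h0 hm

end Dichotomy

section BWeyl

variable {E : Type*} [NormedAddCommGroup E] [NormedSpace ℂ E]

-- For `z ≠ 0`, the space `W = R(Tⁿ)` satisfies `(T - z)⁻¹(W) ⊆ W` and `W + R(T - z) = E`, so that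
-- `T - z` has the same null space and cokernel as its restriction to `W`.

theorem mapsTo_shift_range_pow (T : E →L[ℂ] E) (n : ℕ) (z : ℂ) :
    ∀ x ∈ ((T : E →ₗ[ℂ] E) ^ n).range, (shift T z : E →ₗ[ℂ] E) x ∈ ((T : E →ₗ[ℂ] E) ^ n).range :=
  fun x hx => Submodule.sub_mem _ (mapsTo_range_pow _ n x hx) (Submodule.smul_mem _ z hx)

theorem mem_range_pow_of_shift_mem {T : E →L[ℂ] E} {n : ℕ} {z : ℂ} (hz : z ≠ 0) {x : E}
    (hx : shift T z x ∈ ((T : E →ₗ[ℂ] E) ^ n).range) : x ∈ ((T : E →ₗ[ℂ] E) ^ n).range := by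
  have anti : ∀ j, j ≤ n → ((T : E →ₗ[ℂ] E) ^ n).range ≤ ((T : E →ₗ[ℂ] E) ^ j).range := by
    intro j hj
    obtain ⟨k, rfl⟩ := Nat.exists_eq_add_of_le hj
    rw [pow_add, Module.End.mul_eq_comp]
    exact LinearMap.range_comp_le_range _ _
  have : ∀ j, j ≤ n → x ∈ ((T : E →ₗ[ℂ] E) ^ j).range := by
    intro j
    induction j with
    | zero => exact fun _ => ⟨x, rfl⟩
    | succ j ih =>
      intro hj
      obtain ⟨y, hy⟩ := ih (by omega)
      have h1 : T x ∈ ((T : E →ₗ[ℂ] E) ^ (j + 1)).range :=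
        ⟨y, by rw [pow_succ', Module.End.mul_apply, hy]; rfl⟩
      have h2 : x = z⁻¹ • (T x - shift T z x) := by
        rw [shift_apply, sub_sub_cancel, inv_smul_smul₀ hz]
      rw [h2]
      exact Submodule.smul_mem _ _ (Submodule.sub_mem _ h1 (anti _ hj hx))
  exact this n le_rfl

theorem exists_sub_shift_mem_range_pow (T : E →L[ℂ] E) (n : ℕ) {z : ℂ} (hz : z ≠ 0) (x : E) :
    ∃ y, x - (shift T z : E →ₗ[ℂ] E) y ∈ ((T : E →ₗ[ℂ] E) ^ n).range := by
  induction n generalizing x with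
  | zero => exact ⟨0, x, by simp⟩
  | succ n ih =>
    obtain ⟨y, w, hw⟩ := ih x
    -- `Tⁿ w = z⁻¹ (Tⁿ⁺¹ w - (T - z) Tⁿ w)`
    refine ⟨y - z⁻¹ • ((T : E →ₗ[ℂ] E) ^ n) w, z⁻¹ • w, ?_⟩
    have h1 : (shift T z : E →ₗ[ℂ] E) (((T : E →ₗ[ℂ] E) ^ n) w) =
        ((T : E →ₗ[ℂ] E) ^ (n + 1)) w - z • ((T : E →ₗ[ℂ] E) ^ n) w := by
      rw [pow_succ', Module.End.mul_apply]
      rfl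
    rw [map_sub (shift T z : E →ₗ[ℂ] E), map_smul (shift T z : E →ₗ[ℂ] E), h1, map_smul, smul_sub,
      inv_smul_smul₀ hz, hw]
    abel

theorem bijective_shift_restrict_iff (T : E →L[ℂ] E) (n : ℕ) {z : ℂ} (hz : z ≠ 0) :
    Function.Bijective ((shift T z : E →ₗ[ℂ] E).restrict (mapsTo_shift_range_pow T n z)) ↔
      Function.Bijective (shift T z) :=
  bijective_restrict_iff _ (fun _ => mem_range_pow_of_shift_mem hz)
    (exists_sub_shift_mem_range_pow T n hz)

theorem isWeyl_shift_restrict_iff (T : E →L[ℂ] E) (n : ℕ) {z : ℂ} (hz : z ≠ 0) :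
    IsWeyl ((shift T z : E →ₗ[ℂ] E).restrict (mapsTo_shift_range_pow T n z)) ↔
      IsWeyl (shift T z : E →ₗ[ℂ] E) :=
  isWeyl_restrict_iff _ (fun _ => mem_range_pow_of_shift_mem hz)
    (exists_sub_shift_mem_range_pow T n hz)

/-- The bounded operator `T_n` on `R(Tⁿ)`. -/
noncomputable def restrictRangePowL (T : E →L[ℂ] E) (n : ℕ) :
    ((T : E →ₗ[ℂ] E) ^ n).range →L[ℂ] ((T : E →ₗ[ℂ] E) ^ n).range :=
  (T.comp ((T : E →ₗ[ℂ] E) ^ n).range.subtypeL).codRestrict _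
    fun x => mapsTo_range_pow (T : E →ₗ[ℂ] E) n x x.2

variable [CompleteSpace E]

/-- Near `0`, a B-Weyl operator `T` behaves in one of two ways: either no `T - z` with `z ≠ 0` is
invertible while all of them are Weyl, or all `T - z` with `z ≠ 0` are invertible and `T` has
finite ascent and descent. -/
theorem IsBWeyl.dichotomy {T : E →L[ℂ] E} (hT : IsBWeyl T) :
    (∀ᶠ z in 𝓝[≠] (0 : ℂ), ¬ Function.Bijective (shift T z) ∧
      IsWeyl (shift T z : E →ₗ[ℂ] E)) ∨
    ((∀ᶠ z in 𝓝[≠] (0 : ℂ), Function.Bijective (shift T z)) ∧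
      HasStablePowers (T : E →ₗ[ℂ] E)) := by
  obtain ⟨n, hn, hw⟩ := hT
  have : CompleteSpace ((T : E →ₗ[ℂ] E) ^ n).range := hn.completeSpace_coe
  have hw' : IsWeyl (restrictRangePowL T n : ((T : E →ₗ[ℂ] E) ^ n).range →ₗ[ℂ] _) := hw
  rcases hw'.dichotomy with h | ⟨h1, h2⟩
  · left
    filter_upwards [h, self_mem_nhdsWithin] with z hz hz0
    rw [← bijective_shift_restrict_iff T n hz0, ← isWeyl_shift_restrict_iff T n hz0]
    exact hz
  · right
    refine ⟨?_, HasStablePowers.of_restrictRangePow h2⟩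
    filter_upwards [h1, self_mem_nhdsWithin] with z hz hz0
    exact (bijective_shift_restrict_iff T n hz0).1 hz

theorem HasStablePowers.exists_isClosed_range {T : E →L[ℂ] E}
    (h : HasStablePowers (T : E →ₗ[ℂ] E)) :
    ∃ n, Function.Bijective (restrictRangePow (T : E →ₗ[ℂ] E) n) ∧
      IsClosed (((T : E →ₗ[ℂ] E) ^ n).range : Set E) := by
  obtain ⟨n, h1, h2⟩ := h.exists_bijective_restrictRangePow
  refine ⟨n, h1, ?_⟩
  rw [← ContinuousLinearMap.toLinearMap_pow] at h2 ⊢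
  exact isClosed_range_of_isCompl _ (T ^ n).isClosed_ker h2

theorem HasStablePowers.isBWeyl {T : E →L[ℂ] E} (h : HasStablePowers (T : E →ₗ[ℂ] E)) :
    IsBWeyl T := by
  obtain ⟨n, h1, h2⟩ := h.exists_isClosed_range
  refine ⟨n, h2, isWeyl_of_bijective_of_finiteDimensional h1 ?_⟩
  rw [sub_self, LinearMap.range_zero]
  infer_instance

theorem HasStablePowers.eventually_bijective {T : E →L[ℂ] E}
    (h : HasStablePowers (T : E →ₗ[ℂ] E)) :
    ∀ᶠ z in 𝓝[≠] (0 : ℂ), Function.Bijective (shift T z) := by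
  obtain ⟨n, h1, h2⟩ := h.exists_isClosed_range
  have : CompleteSpace ((T : E →ₗ[ℂ] E) ^ n).range := h2.completeSpace_coe
  have h1' : Function.Bijective (restrictRangePowL T n) := h1
  filter_upwards [(eventually_bijective_shift h1').filter_mono nhdsWithin_le_nhds,
    self_mem_nhdsWithin] with z hz hz0
  exact (bijective_shift_restrict_iff T n hz0).1 hz

end BWeyl

/-! ### Drazin invertibility -/

section Drazin

/-- `s` is Drazin invertible: there is an idempotent `p` commuting with `s` (the spectral idempotent
at `0`) such that `s` is nilpotent on the part of `p` and invertible on the part of `1 - p`. -/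
def IsDrazinInvertible {R : Type*} [Ring R] (s : R) : Prop :=
  ∃ p : R, IsIdempotentElem p ∧ Commute s p ∧ IsNilpotent (s * p) ∧ IsUnit (s + p)

variable {R : Type*} [Ring R] {s p : R}

theorem exists_pow_mul_eq_zero (hp : IsIdempotentElem p) (hc : Commute s p)
    (hn : IsNilpotent (s * p)) : ∃ n, s ^ n * p = 0 := by
  obtain ⟨n, hn⟩ := hn
  refine ⟨n + 1, ?_⟩
  rw [← hp.pow_succ_eq n, ← hc.mul_pow, pow_succ, hn, zero_mul]

theorem add_pow_mul_one_sub (hp : IsIdempotentElem p) (hc : Commute s p) (n : ℕ) :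
    (s + p) ^ n * (1 - p) = s ^ n * (1 - p) := by
  induction n with
  | zero => simp
  | succ n ih =>
    have h1 : (s + p) * (1 - p) = (1 - p) * s := by
      rw [mul_sub, mul_one, add_mul, hp.eq, sub_mul, one_mul, ← hc.eq]; abel
    have h2 : s * (1 - p) = (1 - p) * s := by
      rw [mul_sub, mul_one, sub_mul, one_mul, hc.eq]
    rw [pow_succ, mul_assoc, h1, ← mul_assoc, ih, pow_succ, mul_assoc, mul_assoc, h2]

/-- The spectral idempotent belongs to the bicommutant of `s`: if `x` commutes with `s`, then
`(1 - p) x p = 0 = p x (1 - p)`, since `sⁿ` annihilates `p` and acts as a unit on `1 - p`. -/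
theorem commute_spectralIdempotent (hp : IsIdempotentElem p) (hc : Commute s p)
    (hn : IsNilpotent (s * p)) (hu : IsUnit (s + p)) {x : R} (hx : Commute x s) :
    Commute x p := by
  obtain ⟨n, hn⟩ := exists_pow_mul_eq_zero hp hc hn
  have hcn : Commute (s ^ n) p := hc.pow_left n
  have h1p : s ^ n * (1 - p) = (1 - p) * s ^ n := by
    rw [mul_sub, mul_one, sub_mul, one_mul, hcn.eq]
  have hxn : x * s ^ n = s ^ n * x := (hx.pow_right n).eq
  have hup : (s + p) ^ n * (1 - p) = (1 - p) * (s + p) ^ n := by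
    have : Commute (s + p) p := hc.add_left (Commute.refl p)
    rw [mul_sub, mul_one, sub_mul, one_mul, (this.pow_left n).eq]
  have h1 : (1 - p) * x * p = 0 := by
    refine (hu.pow n).mul_right_eq_zero.1 ?_
    rw [← mul_assoc, ← mul_assoc, add_pow_mul_one_sub hp hc, h1p, mul_assoc (1 - p), ← hxn,
      mul_assoc, mul_assoc x, hn, mul_zero, mul_zero]
  have h2 : p * x * (1 - p) = 0 := by
    refine (hu.pow n).mul_left_eq_zero.1 ?_
    rw [mul_assoc, ← hup, add_pow_mul_one_sub hp hc, ← mul_assoc, mul_assoc p, hxn, ← mul_assoc,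
      ← hcn.eq, hn, zero_mul, zero_mul]
  rw [sub_mul, one_mul, sub_mul, sub_eq_zero] at h1
  rw [mul_sub, mul_one, sub_eq_zero] at h2
  exact h1.trans h2.symm

/-- A Drazin invertible element is strongly `π`-regular. -/
theorem IsDrazinInvertible.exists_pow_eq (h : IsDrazinInvertible s) :
    ∃ (n : ℕ) (v : R), s ^ n = s ^ (n + 1) * v ∧ s ^ n = v * s ^ (n + 1) := by
  obtain ⟨p, hp, hc, hn, hu⟩ := h
  obtain ⟨n, hn⟩ := exists_pow_mul_eq_zero hp hc hn
  have hs : ∀ k, n ≤ k → s ^ k = (s + p) ^ k * (1 - p) := by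
    intro k hk
    obtain ⟨m, rfl⟩ := Nat.exists_eq_add_of_le hk
    rw [add_pow_mul_one_sub hp hc, mul_sub, mul_one, add_comm n m, pow_add, mul_assoc, hn, mul_zero,
      sub_zero]
  obtain ⟨u, hu⟩ := hu
  have hup : Commute (u : R) p := hu ▸ hc.add_left (Commute.refl p)
  have huv : Commute (u : R) (↑u⁻¹ : R) := (Commute.refl (u : R)).units_inv_right
  have hvp : Commute (↑u⁻¹ : R) (1 - p) :=
    (Commute.one_right _).sub_right hup.units_inv_left
  have hu1 : Commute (u : R) (1 - p) := (Commute.one_right _).sub_right hup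
  have hpp : (1 - p) * (1 - p) = 1 - p := hp.one_sub.eq
  refine ⟨n, ↑u⁻¹ * (1 - p), ?_, ?_⟩
  · rw [hs n le_rfl, hs (n + 1) (by omega), ← hu, mul_assoc, hvp.eq, ← mul_assoc (1 - p), hpp,
      ← hvp.eq, pow_succ, mul_assoc, ← mul_assoc (u : R), Units.mul_inv, one_mul]
  · rw [hs n le_rfl, hs (n + 1) (by omega), ← hu, (hu1.pow_left (n + 1)).eq, mul_assoc,
      ← mul_assoc (1 - p), hpp, ← mul_assoc, hvp.eq, mul_assoc, pow_succ', ← mul_assoc (↑u⁻¹ : R),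
      Units.inv_mul, one_mul, (hu1.pow_left n).eq]

theorem IsDrazinInvertible.map {R' : Type*} [Ring R'] (f : R →+* R') (h : IsDrazinInvertible s) :
    IsDrazinInvertible (f s) := by
  obtain ⟨p, hp, hc, hn, hu⟩ := h
  exact ⟨f p, hp.map f, hc.map f, map_mul f s p ▸ hn.map f, map_add f s p ▸ hu.map f⟩

theorem IsDrazinInvertible.op (h : IsDrazinInvertible s) :
    IsDrazinInvertible (MulOpposite.op s) := by
  obtain ⟨p, hp, hc, ⟨n, hn⟩, hu⟩ := h
  refine ⟨MulOpposite.op p, ?_, hc.op, ⟨n, ?_⟩, hu.op⟩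
  · exact congrArg MulOpposite.op hp.eq
  · rw [← MulOpposite.op_mul, ← hc.eq, ← MulOpposite.op_pow, hn, MulOpposite.op_zero]

end Drazin

/-! ### Differences of commuting elements of a Banach algebra -/

section BanachAlgebra

variable {𝔄 : Type*} [NormedRing 𝔄] [NormedAlgebra ℂ 𝔄]

/-- The bicommutant of `a` and `b`. -/
def bicommutant (a b : 𝔄) : Subalgebra ℂ 𝔄 :=
  Subalgebra.centralizer ℂ (Subalgebra.centralizer ℂ {a, b} : Set 𝔄)

variable {a b : 𝔄}

theorem mem_bicommutant_iff {x : 𝔄} :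
    x ∈ bicommutant a b ↔ ∀ y, Commute y a → Commute y b → Commute y x := by
  simp only [bicommutant, Subalgebra.mem_centralizer_iff, SetLike.mem_coe, Set.mem_insert_iff,
    Set.mem_singleton_iff, forall_eq_or_imp, forall_eq]
  exact ⟨fun h y hya hyb => h y ⟨hya.symm, hyb.symm⟩, fun h y hy => h y hy.1.symm hy.2.symm⟩

theorem isUnit_of_isUnit_bicommutant {x : bicommutant a b} (h : IsUnit (x : 𝔄)) : IsUnit x := by
  obtain ⟨u, hu⟩ := h
  have hmem : (↑u⁻¹ : 𝔄) ∈ bicommutant a b := by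
    rw [mem_bicommutant_iff]
    intro y hya hyb
    refine Commute.units_inv_right ?_
    rw [hu]
    exact mem_bicommutant_iff.1 x.2 y hya hyb
  refine ⟨⟨x, ⟨_, hmem⟩, Subtype.ext ?_, Subtype.ext ?_⟩, rfl⟩
  · rw [MulMemClass.coe_mul, ← hu]
    exact u.mul_inv
  · rw [MulMemClass.coe_mul, ← hu]
    exact u.inv_mul

theorem mul_comm_bicommutant (hab : Commute a b) (x y : bicommutant a b) : x * y = y * x := by
  have hx : ∀ z ∈ bicommutant a b, Commute z a ∧ Commute z b := fun z hz =>
    ⟨(mem_bicommutant_iff.1 hz a (Commute.refl a) hab).symm,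
      (mem_bicommutant_iff.1 hz b hab.symm (Commute.refl b)).symm⟩
  exact Subtype.ext (mem_bicommutant_iff.1 y.2 x (hx x x.2).1 (hx x x.2).2)

theorem isClosed_bicommutant (a b : 𝔄) : IsClosed (bicommutant a b : Set 𝔄) :=
  Set.isClosed_centralizer _

/-- Amalgamation of idempotents in a commutative ring: if `t` is nilpotent on each `e i`, it is so
on their union `1 - ∏ (1 - e i)`. -/
theorem isNilpotent_mul_one_sub_prod {R ι : Type*} [CommRing R] (t : R) (e : ι → R) (K : Finset ι)
    (h : ∀ i ∈ K, IsNilpotent (t * e i)) : IsNilpotent (t * (1 - ∏ i ∈ K, (1 - e i))) := by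
  classical
  induction K using Finset.induction_on with
  | empty => simp
  | insert i K hi ih =>
    rw [Finset.prod_insert hi]
    have h1 := ih fun j hj => h j (Finset.mem_insert_of_mem hj)
    have h2 := (Commute.all (t * e i) (∏ i ∈ K, (1 - e i))).isNilpotent_mul_right
      (h i (Finset.mem_insert_self i K))
    have : t * (1 - (1 - e i) * ∏ i ∈ K, (1 - e i)) =
        t * (1 - ∏ i ∈ K, (1 - e i)) + t * e i * ∏ i ∈ K, (1 - e i) := by ring
    rw [this]
    exact (Commute.all _ _).isNilpotent_add h1 h2

theorem isIdempotentElem_prod {R ι : Type*} [CommRing R] (e : ι → R) (K : Finset ι)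
    (h : ∀ i ∈ K, IsIdempotentElem (e i)) : IsIdempotentElem (∏ i ∈ K, e i) := by
  rw [IsIdempotentElem, ← Finset.prod_mul_distrib]
  exact Finset.prod_congr rfl h

variable [CompleteSpace 𝔄]

/-- Let `a` and `b` commute. If `a - μ` and `b - (μ - l)` are Drazin invertible for the finitely
many `μ ∈ σ(a)` with `μ - l ∈ σ(b)`, then `a - b - l` is Drazin invertible. With `p μ` and `q μ` the
corresponding idempotents, the idempotent of `a - b - l` is `1 - ∏ (1 - p μ q μ)`, as is seen by
evaluating characters of the bicommutant. -/
theorem IsDrazinInvertible.sub_of_commute (hab : Commute a b) (l : ℂ) (K : Finset ℂ)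
    (hK : ∀ μ ∈ spectrum ℂ a, μ - l ∈ spectrum ℂ b → μ ∈ K)
    (ha : ∀ μ ∈ K, IsDrazinInvertible (a - algebraMap ℂ 𝔄 μ))
    (hb : ∀ μ ∈ K, IsDrazinInvertible (b - algebraMap ℂ 𝔄 (μ - l))) :
    IsDrazinInvertible (a - b - algebraMap ℂ 𝔄 l) := by
  let 𝔅 := bicommutant a b
  let _ : NormedCommRing 𝔅 :=
    { (inferInstance : NormedRing 𝔅) with mul_comm := mul_comm_bicommutant hab }
  let _ : NormedAlgebra ℂ 𝔅 := inferInstanceAs (NormedAlgebra ℂ (bicommutant a b))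
  have : CompleteSpace 𝔅 := (isClosed_bicommutant a b).completeSpace_coe
  have ha𝔅 : a ∈ 𝔅 := mem_bicommutant_iff.2 fun y hy _ => hy
  have hb𝔅 : b ∈ 𝔅 := mem_bicommutant_iff.2 fun y _ hy => hy
  let a' : 𝔅 := ⟨a, ha𝔅⟩
  let b' : 𝔅 := ⟨b, hb𝔅⟩
  -- Spectral idempotents of bicommuting elements lie in the commutative algebra `𝔅`.
  have hlift : ∀ (c : 𝔅) (z : ℂ), (∀ y, Commute y a → Commute y b → Commute y (c : 𝔄)) →
      IsDrazinInvertible ((c : 𝔄) - algebraMap ℂ 𝔄 z) →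
      ∃ p : 𝔅, IsIdempotentElem p ∧ IsNilpotent ((c - algebraMap ℂ 𝔅 z) * p) ∧
        IsUnit (c - algebraMap ℂ 𝔅 z + p) := by
    rintro c z hc ⟨p, hp, hcp, hn, hu⟩
    have hp𝔅 : p ∈ 𝔅 := mem_bicommutant_iff.2 fun y hya hyb =>
      commute_spectralIdempotent hp hcp hn hu
        ((hc y hya hyb).sub_right (Algebra.commute_algebraMap_right z y))
    refine ⟨⟨p, hp𝔅⟩, Subtype.ext hp, ?_, isUnit_of_isUnit_bicommutant hu⟩
    obtain ⟨n, hn⟩ := hn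
    exact ⟨n, Subtype.ext hn⟩
  have hp : ∀ μ, ∃ p : 𝔅, μ ∈ K → IsIdempotentElem p ∧
      IsNilpotent ((a' - algebraMap ℂ 𝔅 μ) * p) ∧ IsUnit (a' - algebraMap ℂ 𝔅 μ + p) := by
    intro μ
    by_cases hμ : μ ∈ K
    · obtain ⟨p, hp⟩ := hlift a' μ (fun y hy _ => hy) (ha μ hμ)
      exact ⟨p, fun _ => hp⟩
    · exact ⟨0, fun h => absurd h hμ⟩
  have hq : ∀ μ, ∃ q : 𝔅, μ ∈ K → IsIdempotentElem q ∧
      IsNilpotent ((b' - algebraMap ℂ 𝔅 (μ - l)) * q) ∧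
        IsUnit (b' - algebraMap ℂ 𝔅 (μ - l) + q) := by
    intro μ
    by_cases hμ : μ ∈ K
    · obtain ⟨q, hq⟩ := hlift b' (μ - l) (fun y _ hy => hy) (hb μ hμ)
      exact ⟨q, fun _ => hq⟩
    · exact ⟨0, fun h => absurd h hμ⟩
  choose p hp using hp
  choose q hq using hq
  let t : 𝔅 := a' - b' - algebraMap ℂ 𝔅 l
  let g : 𝔅 := 1 - ∏ μ ∈ K, (1 - p μ * q μ)
  have hidem : ∀ μ ∈ K, IsIdempotentElem (p μ * q μ) := fun μ hμ =>
    (hp μ hμ).1.mul (hq μ hμ).1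
  have hg : IsIdempotentElem g :=
    (isIdempotentElem_prod _ K fun μ hμ => (hidem μ hμ).one_sub).one_sub
  have hnil : IsNilpotent (t * g) := by
    refine isNilpotent_mul_one_sub_prod t (fun μ => p μ * q μ) K fun μ hμ => ?_
    have h1 := (Commute.all ((a' - algebraMap ℂ 𝔅 μ) * p μ) (q μ)).isNilpotent_mul_right
      (hp μ hμ).2.1
    have h2 := (Commute.all ((b' - algebraMap ℂ 𝔅 (μ - l)) * q μ) (p μ)).isNilpotent_mul_right
      (hq μ hμ).2.1
    have h3 := (Commute.all _ _).isNilpotent_sub h1 h2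
    -- `t p q = (a - μ) p q - (b - (μ - l)) q p`
    convert h3 using 1
    simp only [t, map_sub]
    ring
  have hχa : ∀ (χ : WeakDual.characterSpace ℂ 𝔅) (c : 𝔅), χ c ∈ spectrum ℂ (c : 𝔄) := by
    intro χ c
    rw [spectrum.mem_iff]
    intro hu
    have hu' : IsUnit (algebraMap ℂ 𝔅 (χ c) - c) := isUnit_of_isUnit_bicommutant hu
    have := hu'.map χ
    rw [map_sub, AlgHomClass.commutes, Algebra.algebraMap_self_apply, sub_self] at this
    exact not_isUnit_zero this
  -- On a character `χ` with `χ c = z`, a spectral idempotent of `c` at `z` takes the value `1`.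
  have hχp : ∀ (χ : WeakDual.characterSpace ℂ 𝔅) (c e : 𝔅) (z : ℂ), IsIdempotentElem e →
      IsUnit (c - algebraMap ℂ 𝔅 z + e) → χ c = z → χ e = 1 := by
    intro χ c e z he hu hc
    have h1 := hu.map χ
    rw [map_add, map_sub, AlgHomClass.commutes, Algebra.algebraMap_self_apply, hc, sub_self,
      zero_add] at h1
    exact (IsIdempotentElem.iff_eq_zero_or_one.1 (he.map χ)).resolve_left h1.ne_zero
  have hunit : IsUnit (t + g) := by
    by_contra hne
    obtain ⟨χ, hχ⟩ := WeakDual.CharacterSpace.exists_apply_eq_zero hne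
    have ht : χ t = χ a' - χ b' - l := by
      simp only [t, map_sub, AlgHomClass.commutes, Algebra.algebraMap_self_apply]
    rw [map_add] at hχ
    by_cases h0 : χ t = 0
    · have hbl : χ b' = χ a' - l := by rw [ht] at h0; linear_combination -h0
      have hμ : χ a' ∈ K := hK _ (hχa χ a') (hbl ▸ hχa χ b')
      have h1 := hχp χ a' _ _ (hp _ hμ).1 (hp _ hμ).2.2 rfl
      have h2 := hχp χ b' _ _ (hq _ hμ).1 (hq _ hμ).2.2 hbl
      have h3 : χ g = 1 := by
        simp only [g, map_sub, map_one, map_prod]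
        rw [Finset.prod_eq_zero hμ, sub_zero]
        rw [map_mul, h1, h2, mul_one, sub_self]
      rw [h0, h3, zero_add] at hχ
      exact one_ne_zero hχ
    · have h1 := (hnil.map χ).eq_zero
      rw [map_mul] at h1
      rcases mul_eq_zero.1 h1 with h | h
      · exact h0 h
      · rw [h, add_zero] at hχ
        exact h0 hχ
  refine ⟨g, congrArg Subtype.val hg, congrArg Subtype.val (mul_comm t g), ?_,
    hunit.map 𝔅.val⟩
  exact hnil.map 𝔅.val

end BanachAlgebra

/-! ### Drazin invertibility in subalgebras and of operators -/

theorem commute_inverse_left {R : Type*} [Ring R] {a b : R} (ha : IsUnit a) (h : Commute a b) :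
    Commute (Ring.inverse a) b := by
  obtain ⟨u, rfl⟩ := ha
  rw [Ring.inverse_unit]
  exact h.units_inv_left

/-- The spectral idempotent at `0` as a limit of elements obtained from `s` by algebraic operations
and inversion. -/
theorem exists_tendsto_one_sub {𝔄 : Type*} [NormedRing 𝔄] [NormedAlgebra ℂ 𝔄] [CompleteSpace 𝔄]
    {s p : 𝔄} (hp : IsIdempotentElem p) (hc : Commute s p) (hn : IsNilpotent (s * p))
    (hu : IsUnit (s + p)) : ∃ (n : ℕ) (w : ℂ → 𝔄),
      (∀ᶠ z in 𝓝[≠] (0 : ℂ), (s ^ n - z • 1) * w z = 1 ∧ w z * (s ^ n - z • 1) = 1) ∧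
      Tendsto (fun z => s ^ n * w z) (𝓝[≠] 0) (𝓝 (1 - p)) := by
  obtain ⟨n, hn0⟩ := exists_pow_mul_eq_zero hp hc hn
  have hS : s ^ n = (s + p) ^ n * (1 - p) := by
    rw [add_pow_mul_one_sub hp hc, mul_sub, mul_one, hn0, sub_zero]
  set U := (s + p) ^ n with hU
  have hUu : IsUnit U := hu.pow n
  have hUp : Commute U p := (hc.add_left (Commute.refl p)).pow_left n
  have hp1 : (1 - p) * (1 - p) = 1 - p := hp.one_sub.eq
  have hp0 : (1 - p) * p = 0 := by rw [sub_mul, one_mul, hp.eq, sub_self]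
  have hp0' : p * (1 - p) = 0 := by rw [mul_sub, mul_one, hp.eq, sub_self]
  have hcont : Continuous (fun z : ℂ => U - z • (1 : 𝔄)) := by fun_prop
  let v : ℂ → 𝔄 := fun z => Ring.inverse (U - z • 1)
  have hSw : ∀ z, s ^ n * (v z * (1 - p) - z⁻¹ • p) = s ^ n * (v z * (1 - p)) := fun z => by
    rw [mul_sub, mul_smul_comm, hn0, smul_zero, sub_zero]
  refine ⟨n, fun z => v z * (1 - p) - z⁻¹ • p, ?_, ?_⟩
  · have hunits : ∀ᶠ z in 𝓝 (0 : ℂ), IsUnit (U - z • (1 : 𝔄)) := by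
      refine hcont.continuousAt.eventually_mem (Units.isOpen.mem_nhds ?_)
      simpa using hUu
    filter_upwards [hunits.filter_mono nhdsWithin_le_nhds, self_mem_nhdsWithin] with z hzu hz0
    have hUzp : Commute (U - z • 1) p := hUp.sub_left ((Commute.one_left p).smul_left z)
    have hvp : Commute (v z) p := commute_inverse_left hzu hUzp
    have hv1 : (U - z • 1) * v z = 1 := Ring.mul_inverse_cancel _ hzu
    have hv2 : v z * (U - z • 1) = 1 := Ring.inverse_mul_cancel _ hzu
    have hc1 : Commute (v z) (1 - p) := (Commute.one_right _).sub_right hvp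
    have hc2 : Commute (U - z • 1) (1 - p) := (Commute.one_right _).sub_right hUzp
    have hSz : s ^ n - z • 1 = (U - z • 1) * (1 - p) - z • p := by
      rw [hS, sub_mul, smul_mul_assoc, one_mul, smul_sub]
      abel
    have e1 : (U - z • 1) * (1 - p) * (v z * (1 - p)) = 1 - p := by
      rw [mul_assoc, ← mul_assoc (1 - p), ← hc1.eq, mul_assoc (v z), hp1, ← mul_assoc, hv1, one_mul]
    have e2 : (U - z • 1) * (1 - p) * p = 0 := by rw [mul_assoc, hp0, mul_zero]
    have e3 : p * (v z * (1 - p)) = 0 := by rw [hc1.eq, ← mul_assoc, hp0', zero_mul]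
    have e4 : v z * (1 - p) * ((U - z • 1) * (1 - p)) = 1 - p := by
      rw [mul_assoc, ← mul_assoc (1 - p), ← hc2.eq, mul_assoc (U - z • 1), hp1, ← mul_assoc, hv2,
        one_mul]
    have e5 : v z * (1 - p) * p = 0 := by rw [mul_assoc, hp0, mul_zero]
    have e6 : p * ((U - z • 1) * (1 - p)) = 0 := by rw [hc2.eq, ← mul_assoc, hp0', zero_mul]
    constructor
    · rw [hSz, sub_mul _ (z • p), mul_sub (_ * (1 - p)), mul_sub (z • p), e1, mul_smul_comm,
        e2, smul_mul_assoc, e3, smul_mul_smul_comm, hp.eq, mul_inv_cancel₀ hz0]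
      simp
    · rw [hSz, sub_mul _ (z⁻¹ • p), mul_sub (_ * (1 - p)), mul_sub (z⁻¹ • p), e4,
        mul_smul_comm, e5, smul_mul_assoc, e6, smul_mul_smul_comm, hp.eq, inv_mul_cancel₀ hz0]
      simp
  · simp_rw [hSw]
    obtain ⟨u, hu⟩ := hUu
    have h1 : ContinuousAt v 0 := by
      refine ContinuousAt.comp (g := Ring.inverse) ?_ hcont.continuousAt
      rw [zero_smul, sub_zero, ← hu]
      exact NormedRing.inverse_continuousAt u
    have h2 : ContinuousAt (fun z => s ^ n * (v z * (1 - p))) 0 :=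
      continuousAt_const.mul (h1.mul continuousAt_const)
    have h3 : s ^ n * (v 0 * (1 - p)) = 1 - p := by
      have : Commute (v 0) (1 - p) := by
        simp only [v, zero_smul, sub_zero]
        exact commute_inverse_left ⟨u, hu⟩ ((Commute.one_right U).sub_right hUp)
      rw [this.eq, hS, mul_assoc, ← mul_assoc (1 - p), hp1, ← this.eq, ← mul_assoc]
      simp only [v, zero_smul, sub_zero]
      rw [Ring.mul_inverse_cancel _ ⟨u, hu⟩, one_mul]
    have := h2.tendsto.mono_left (nhdsWithin_le_nhds (s := {0}ᶜ))
    rwa [h3] at this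

/-- An isometric embedding of Banach algebras which reflects invertibility reflects Drazin
invertibility, because the idempotent `p` of an element of the image belongs to the image:
`1 - p` is the limit of `sⁿ (sⁿ - z)⁻¹` as `z → 0`. -/
theorem IsDrazinInvertible.of_isometry {R 𝔄 : Type*} [NormedRing R] [NormedAlgebra ℂ R]
    [CompleteSpace R] [NormedRing 𝔄] [NormedAlgebra ℂ 𝔄] [CompleteSpace 𝔄] (f : R →ₐ[ℂ] 𝔄)
    (hf : Isometry f) (hunit : ∀ x, IsUnit (f x) → IsUnit x) {t : R}
    (h : IsDrazinInvertible (f t)) : IsDrazinInvertible t := by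
  obtain ⟨p, hp, hc, hn, hu⟩ := h
  obtain ⟨n, w, hw, hlim⟩ := exists_tendsto_one_sub hp hc hn hu
  have hmem : ∀ᶠ z in 𝓝[≠] (0 : ℂ), f t ^ n * w z ∈ Set.range f := by
    filter_upwards [hw] with z hz
    have hshift : f t ^ n - z • 1 = f (t ^ n - z • 1) := by
      rw [map_sub, map_pow, map_smul, map_one]
    rw [hshift] at hz
    obtain ⟨u, hu⟩ := hunit _ ⟨⟨_, _, hz.1, hz.2⟩, rfl⟩
    refine ⟨t ^ n * ↑u⁻¹, ?_⟩
    rw [map_mul, map_pow]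
    congr 1
    refine left_inv_eq_right_inv ?_ hz.1
    rw [← hu, ← map_mul, Units.inv_mul, map_one]
  obtain ⟨q, hq⟩ := hf.isClosedEmbedding.isClosed_range.mem_of_tendsto hlim hmem
  have hpq : f (1 - q) = p := by rw [map_sub, map_one, hq, sub_sub_cancel]
  refine ⟨1 - q, hf.injective ?_, hf.injective ?_, ?_, hunit _ ?_⟩
  · rw [map_mul, hpq, hp.eq]
  · rw [map_mul, map_mul, hpq, hc.eq]
  · obtain ⟨k, hk⟩ := hn
    exact ⟨k, hf.injective (by rw [map_pow, map_mul, hpq, hk, map_zero])⟩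
  · rwa [map_add, hpq]

section DrazinOperators

variable {E : Type*} [NormedAddCommGroup E] [NormedSpace ℂ E]

theorem IsDrazinInvertible.hasStablePowers {T : E →L[ℂ] E} (h : IsDrazinInvertible T) :
    HasStablePowers (T : E →ₗ[ℂ] E) := by
  obtain ⟨n, v, h1, h2⟩ := h.exists_pow_eq
  refine ⟨n, le_antisymm (fun x hx => ?_) (fun x hx => ?_), le_antisymm ?_ ?_⟩
  · rw [LinearMap.mem_ker] at hx ⊢
    rw [pow_succ', Module.End.mul_apply, hx, map_zero]
  · rw [← ContinuousLinearMap.toLinearMap_pow] at hx ⊢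
    have hx' : (T ^ (n + 1)) x = 0 := hx
    change (T ^ n) x = 0
    rw [h2, mul_apply_eq_comp, hx', map_zero]
  · rintro _ ⟨x, rfl⟩
    refine ⟨v x, ?_⟩
    rw [← ContinuousLinearMap.toLinearMap_pow, ← ContinuousLinearMap.toLinearMap_pow]
    exact (congrArg (fun f : E →L[ℂ] E => f x) h1).symm
  · rw [pow_succ, Module.End.mul_eq_comp]
    exact LinearMap.range_comp_le_range _ _

variable [CompleteSpace E]

/-- A bounded operator with finite ascent and descent is Drazin invertible, its idempotent being the
projection onto `N(Tⁿ)` along `R(Tⁿ)`. -/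
theorem HasStablePowers.isDrazinInvertible {T : E →L[ℂ] E}
    (h : HasStablePowers (T : E →ₗ[ℂ] E)) : IsDrazinInvertible T := by
  obtain ⟨n, ⟨hinj, hsurj⟩, hcompl⟩ := h.exists_bijective_restrictRangePow
  have hN : IsClosed (((T : E →ₗ[ℂ] E) ^ n).ker : Set E) := by
    rw [← ContinuousLinearMap.toLinearMap_pow]
    exact (T ^ n).isClosed_ker
  have hR : IsClosed (((T : E →ₗ[ℂ] E) ^ n).range : Set E) := by
    rw [← ContinuousLinearMap.toLinearMap_pow] at hcompl ⊢
    exact isClosed_range_of_isCompl _ (T ^ n).isClosed_ker hcompl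
  have htop : Submodule.IsTopCompl ((T : E →ₗ[ℂ] E) ^ n).ker ((T : E →ₗ[ℂ] E) ^ n).range :=
    Submodule.IsCompl.isTopCompl_of_isClosed hcompl.symm hN hR
  let P := Submodule.projectionL _ _ htop
  have hPmem : ∀ x, P x ∈ ((T : E →ₗ[ℂ] E) ^ n).ker := Submodule.projectionL_apply_mem htop
  have hP0 : ∀ x, P x = 0 ↔ x ∈ ((T : E →ₗ[ℂ] E) ^ n).range := fun x =>
    Submodule.projectionL_apply_eq_zero_iff htop
  have hP1 : ∀ x, P x = x ↔ x ∈ ((T : E →ₗ[ℂ] E) ^ n).ker :=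
    Submodule.projectionL_eq_self_iff htop
  have hPsub : ∀ x, x - P x ∈ ((T : E →ₗ[ℂ] E) ^ n).range := fun x => by
    rw [← hP0, map_sub, (hP1 _).2 (hPmem x), sub_self]
  have hTN : ∀ x ∈ ((T : E →ₗ[ℂ] E) ^ n).ker, T x ∈ ((T : E →ₗ[ℂ] E) ^ n).ker := fun x hx => by
    rw [LinearMap.mem_ker] at hx ⊢
    have : ((T : E →ₗ[ℂ] E) ^ n) ((T : E →ₗ[ℂ] E) x) =
        (T : E →ₗ[ℂ] E) (((T : E →ₗ[ℂ] E) ^ n) x) := by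
      rw [← Module.End.mul_apply, ← Module.End.mul_apply, ← pow_succ, pow_succ']
    exact this.trans (by rw [hx, map_zero])
  have hidem : IsIdempotentElem P := Submodule.isIdempotentElem_projectionL htop
  have hcomm : Commute T P := by
    ext x
    change T (P x) = P (T x)
    have h1 : T x = T (P x) + T (x - P x) := by rw [map_sub]; abel
    have h2 : P (T (x - P x)) = 0 := (hP0 _).2 (mapsTo_range_pow _ n _ (hPsub x))
    rw [h1, map_add, h2, add_zero, (hP1 _).2 (hTN _ (hPmem x))]
  have hnil : IsNilpotent (T * P) := by
    refine ⟨n + 1, ?_⟩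
    rw [hcomm.mul_pow, hidem.pow_succ_eq, pow_succ']
    ext x
    have h1 : (T ^ n) (P x) = 0 := by
      have := hPmem x
      rw [← ContinuousLinearMap.toLinearMap_pow] at this
      exact this
    change T ((T ^ n) (P x)) = 0
    rw [h1, map_zero]
  refine ⟨P, hidem, hcomm, hnil, ?_⟩
  -- The second factor is `T` on `R(Tⁿ)` and the identity on `N(Tⁿ)`; the first is unipotent.
  have hfac : T + P = (1 + T * P) * (T * (1 - P) + P) := by
    have h1 : T * P * (T * (1 - P)) = 0 := by
      rw [mul_assoc, ← mul_assoc P, ← hcomm.eq, mul_assoc T P, mul_sub, mul_one, hidem.eq, sub_self,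
        mul_zero, mul_zero]
    rw [add_mul, one_mul, mul_add, h1, mul_assoc T P P, hidem.eq, mul_sub, mul_one]
    abel
  rw [hfac]
  refine hnil.isUnit_one_add.mul (ContinuousLinearMap.isUnit_iff_bijective.2 ⟨?_, ?_⟩)
  · rw [injective_iff_map_eq_zero]
    intro x hx
    have hx' : T (x - P x) + P x = 0 := hx
    have h1 : P (T (x - P x)) = 0 := (hP0 _).2 (mapsTo_range_pow _ n _ (hPsub x))
    have h2 : P x = 0 := by
      have := congrArg P hx'
      rwa [map_add, h1, zero_add, map_zero, (hP1 _).2 (hPmem x)] at this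
    rw [h2, sub_zero, add_zero] at hx'
    have h3 : (⟨x, (hP0 x).1 h2⟩ : ((T : E →ₗ[ℂ] E) ^ n).range) = 0 :=
      hinj (by rw [map_zero]; exact Subtype.ext hx')
    exact congrArg Subtype.val h3
  · intro y
    obtain ⟨⟨r, hr⟩, hr'⟩ := hsurj ⟨y - P y, hPsub y⟩
    have hr2 : T r = y - P y := congrArg Subtype.val hr'
    refine ⟨r + P y, ?_⟩
    change T (r + P y - P (r + P y)) + P (r + P y) = y
    rw [map_add P, (hP0 r).2 hr, zero_add, (hP1 _).2 (hPmem y), add_sub_cancel_right, hr2,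
      sub_add_cancel]

end DrazinOperators

/-! ### Duality -/

section Duality

variable {E : Type*} [NormedAddCommGroup E] [NormedSpace ℂ E]

theorem adjoint_apply (T : E →L[ℂ] E) (f : StrongDual ℂ E) (x : E) : adjoint T f x = f (T x) := rfl

theorem adjoint_shift (T : E →L[ℂ] E) (z : ℂ) : adjoint (shift T z) = shift (adjoint T) z := by
  ext f x
  simp [adjoint_apply, shift_apply]

theorem norm_adjoint (T : E →L[ℂ] E) : ‖adjoint T‖ = ‖T‖ := by
  refine le_antisymm ?_ ?_
  · refine (adjoint T).opNorm_le_bound (norm_nonneg _) fun f => ?_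
    rw [mul_comm]
    exact f.opNorm_comp_le T
  · refine T.opNorm_le_bound (norm_nonneg (adjoint T)) fun x => ?_
    obtain ⟨g, hg1, hg⟩ := exists_dual_vector'' ℂ (T x)
    have h1 : ‖adjoint T g x‖ = ‖T x‖ := by rw [adjoint_apply, hg]; simp
    rw [← h1]
    calc ‖adjoint T g x‖ ≤ ‖adjoint T g‖ * ‖x‖ := (adjoint T g).le_opNorm x
      _ ≤ (‖adjoint T‖ * 1) * ‖x‖ := by
        gcongr
        exact ((adjoint T).le_opNorm g).trans (by gcongr)
      _ = ‖adjoint T‖ * ‖x‖ := by rw [mul_one]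

/-- Passage to the adjoint, as an algebra homomorphism from the opposite algebra. -/
noncomputable def adjointHom (E : Type*) [NormedAddCommGroup E] [NormedSpace ℂ E] :
    (E →L[ℂ] E)ᵐᵒᵖ →ₐ[ℂ] (StrongDual ℂ E →L[ℂ] StrongDual ℂ E) where
  toFun T := adjoint T.unop
  map_one' := rfl
  map_mul' _ _ := rfl
  map_zero' := by ext f x; simp [adjoint_apply]
  map_add' S T := by ext f x; simp [adjoint_apply]
  commutes' z := by
    ext f x
    simp [adjoint_apply, Algebra.algebraMap_eq_smul_one]

theorem isometry_adjointHom : Isometry (adjointHom E) := by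
  refine Isometry.of_dist_eq fun S T => ?_
  rw [dist_eq_norm, dist_eq_norm]
  refine Eq.trans ?_ (norm_adjoint (S - T).unop)
  congr 1
  exact (map_sub (adjointHom E) _ _).symm

/-- The Hahn-Banach theorem: a closed subspace and a point outside it are separated by a functional
that vanishes on the subspace. -/
theorem exists_dual_eq_zero_of_notMem {W : Submodule ℂ E} (hW : IsClosed (W : Set E)) {x : E}
    (hx : x ∉ W) : ∃ f : StrongDual ℂ E, (∀ w ∈ W, f w = 0) ∧ f x ≠ 0 := by
  have : IsClosed (W : Set E) := hW
  have hq : (Submodule.Quotient.mk x : E ⧸ W) ≠ 0 := by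
    rwa [Ne, Submodule.Quotient.mk_eq_zero]
  obtain ⟨f, hf⟩ := SeparatingDual.exists_ne_zero (R := ℂ) hq
  refine ⟨f.comp W.mkQL, fun w hw => ?_, hf⟩
  have : W.mkQL w = 0 := (Submodule.Quotient.mk_eq_zero W).2 hw
  rw [ContinuousLinearMap.comp_apply, this, map_zero]

/-- `T` is bounded below. -/
def IsBoundedBelow (T : E →L[ℂ] E) : Prop := ∃ c > 0, ∀ x, c * ‖x‖ ≤ ‖T x‖

theorem IsBoundedBelow.injective {T : E →L[ℂ] E} (h : IsBoundedBelow T) :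
    Function.Injective T := by
  obtain ⟨c, hc, h⟩ := h
  rw [injective_iff_map_eq_zero]
  intro x hx
  have := h x
  rw [hx, norm_zero] at this
  exact norm_eq_zero.1 (le_antisymm (nonpos_of_mul_nonpos_right this hc) (norm_nonneg x))

variable [CompleteSpace E]

theorem isBoundedBelow_of_bijective {T : E →L[ℂ] E} (h : Function.Bijective T) :
    IsBoundedBelow T := by
  obtain ⟨C, hC, h1⟩ := T.exists_preimage_norm_le h.2
  refine ⟨C⁻¹, inv_pos.2 hC, fun x => ?_⟩
  obtain ⟨y, hy, hle⟩ := h1 (T x)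
  rw [h.1 hy] at hle
  rwa [inv_mul_le_iff₀ hC]

/-- An operator which, together with its adjoint, is bounded below is bijective. -/
theorem bijective_of_isBoundedBelow {T : E →L[ℂ] E} (h : IsBoundedBelow T)
    (h' : Function.Injective (adjoint T)) : Function.Bijective T := by
  refine ⟨h.injective, ?_⟩
  obtain ⟨c, hc, h⟩ := h
  have hcl : IsClosed ((T : E →ₗ[ℂ] E).range : Set E) := by
    have : AntilipschitzWith (Real.toNNReal c⁻¹) T := by
      refine T.antilipschitz_of_bound fun x => ?_
      rw [Real.coe_toNNReal _ (inv_nonneg.2 hc.le), ← div_eq_inv_mul, le_div_iff₀' hc]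
      exact h x
    exact this.isClosed_range T.uniformContinuous
  intro x
  by_contra hx
  obtain ⟨f, hf, hfx⟩ := exists_dual_eq_zero_of_notMem hcl (x := x)
    (by rintro ⟨y, hy⟩; exact hx ⟨y, hy⟩)
  have : f = 0 := h' (by
    rw [map_zero]
    ext y
    exact hf _ ⟨y, rfl⟩)
  rw [this] at hfx
  exact hfx rfl

theorem bijective_adjoint_iff {T : E →L[ℂ] E} :
    Function.Bijective (adjoint T) ↔ Function.Bijective T := by
  constructor
  · intro h
    obtain ⟨C, hC, h1⟩ := (adjoint T).exists_preimage_norm_le h.2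
    -- `T` is bounded below: a norming functional of `x` is `T* f` with `‖f‖ ≤ C`.
    refine bijective_of_isBoundedBelow ⟨C⁻¹, inv_pos.2 hC, fun x => ?_⟩ h.1
    rw [inv_mul_le_iff₀ hC]
    obtain ⟨g, hg1, hg⟩ := exists_dual_vector'' ℂ x
    obtain ⟨f, rfl, hf⟩ := h1 g
    have h2 : ‖f (T x)‖ = ‖x‖ := by rw [← adjoint_apply, hg]; simp
    rw [← h2]
    refine (f.le_opNorm _).trans ?_
    gcongr
    exact hf.trans (mul_le_of_le_one_right hC.le hg1)
  · intro h
    rw [← ContinuousLinearMap.isUnit_iff_bijective] at h ⊢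
    exact h.op.map (adjointHom E)

theorem spectrum_adjoint (T : E →L[ℂ] E) : spectrum ℂ (adjoint T) = spectrum ℂ T := by
  ext z
  rw [mem_spectrum_iff, mem_spectrum_iff, ← adjoint_shift, bijective_adjoint_iff]

omit [CompleteSpace E] in
theorem IsDrazinInvertible.adjoint {T : E →L[ℂ] E} (h : IsDrazinInvertible T) :
    IsDrazinInvertible (WeylBrowder.adjoint T) :=
  IsDrazinInvertible.map (R' := StrongDual ℂ E →L[ℂ] StrongDual ℂ E) (adjointHom E).toRingHom h.op

theorem IsDrazinInvertible.of_adjoint {T : E →L[ℂ] E}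
    (h : IsDrazinInvertible (WeylBrowder.adjoint T)) : IsDrazinInvertible T := by
  have h1 : IsDrazinInvertible (MulOpposite.op T) := by
    refine IsDrazinInvertible.of_isometry (𝔄 := StrongDual ℂ E →L[ℂ] StrongDual ℂ E)
      (adjointHom E) isometry_adjointHom (fun S hS => ?_) h
    rw [ContinuousLinearMap.isUnit_iff_bijective] at hS
    have h2 := ContinuousLinearMap.isUnit_iff_bijective.2 (bijective_adjoint_iff.1 hS)
    exact h2.op
  exact h1.op.map (RingEquiv.opOp (E →L[ℂ] E)).symm.toRingHom

end Duality

/-! ### Duality for Fredholm and Weyl operators -/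

section Preannihilator

variable {F V : Type*} [NormedAddCommGroup F] [NormedSpace ℂ F] [AddCommGroup V] [Module ℂ V]

/-- Evaluation of the functionals `J f` with `f` in a subspace `C`. -/
def evalOn (J : F →ₗ[ℂ] V →ₗ[ℂ] ℂ) (C : Submodule ℂ F) : V →ₗ[ℂ] Module.Dual ℂ C :=
  (J.domRestrict C).flip

/-- The common null space of the functionals `J f` with `f` in a subspace `C`. -/
def preannihilator (J : F →ₗ[ℂ] V →ₗ[ℂ] ℂ) (C : Submodule ℂ F) : Submodule ℂ V :=
  (evalOn J C).ker

theorem mem_preannihilator {J : F →ₗ[ℂ] V →ₗ[ℂ] ℂ} {C : Submodule ℂ F} {x : V} :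
    x ∈ preannihilator J C ↔ ∀ f ∈ C, J f x = 0 := by
  rw [preannihilator, LinearMap.mem_ker, LinearMap.ext_iff]
  exact ⟨fun h f hf => h ⟨f, hf⟩, fun h f => h f f.2⟩

theorem finiteDimensional_quotient_preannihilator (J : F →ₗ[ℂ] V →ₗ[ℂ] ℂ) (C : Submodule ℂ F)
    [FiniteDimensional ℂ C] : FiniteDimensional ℂ (V ⧸ preannihilator J C) :=
  (evalOn J C).quotKerEquivRange.symm.finiteDimensional

theorem finiteDimensional_of_disjoint_preannihilator (J : F →ₗ[ℂ] V →ₗ[ℂ] ℂ) (C : Submodule ℂ F)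
    [FiniteDimensional ℂ C] {N : Submodule ℂ V} (h : Disjoint N (preannihilator J C)) :
    FiniteDimensional ℂ N := by
  refine Module.Finite.of_injective ((evalOn J C).domRestrict N) ?_
  rw [← LinearMap.ker_eq_bot, LinearMap.ker_eq_bot']
  rintro ⟨x, hx⟩ h0
  exact Subtype.ext (Submodule.disjoint_def.1 h x hx h0)

end Preannihilator

section FredholmDuality

variable {E : Type*} [NormedAddCommGroup E] [NormedSpace ℂ E] [CompleteSpace E]

/-- The pairing of the dual of `E` with `E`. -/
noncomputable def dualPairing (E : Type*) [NormedAddCommGroup E] [NormedSpace ℂ E] :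
    StrongDual ℂ E →ₗ[ℂ] E →ₗ[ℂ] ℂ where
  toFun f := f
  map_add' _ _ := rfl
  map_smul' _ _ := rfl

omit [CompleteSpace E] in
theorem isClosed_preannihilator (C : Submodule ℂ (StrongDual ℂ E)) :
    IsClosed (preannihilator (dualPairing E) C : Set E) := by
  have : (preannihilator (dualPairing E) C : Set E) = ⋂ f ∈ C, {x | f x = 0} := by
    ext x
    rw [SetLike.mem_coe, mem_preannihilator, Set.mem_iInter₂]
    rfl
  rw [this]
  exact isClosed_biInter fun f _ => isClosed_eq f.continuous continuous_const

omit [CompleteSpace E] in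
theorem mem_ker_adjoint {T : E →L[ℂ] E} {f : StrongDual ℂ E} :
    f ∈ (adjoint T : StrongDual ℂ E →ₗ[ℂ] StrongDual ℂ E).ker ↔ ∀ x, f (T x) = 0 := by
  rw [LinearMap.mem_ker]
  exact ⟨fun h x => congrArg (fun g : StrongDual ℂ E => g x) h, fun h => ContinuousLinearMap.ext h⟩

omit [CompleteSpace E] in
theorem preannihilator_ker_adjoint {T : E →L[ℂ] E} (hT : IsClosed ((T : E →ₗ[ℂ] E).range : Set E)) :
    preannihilator (dualPairing E) (adjoint T : StrongDual ℂ E →ₗ[ℂ] StrongDual ℂ E).ker =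
      (T : E →ₗ[ℂ] E).range := by
  refine le_antisymm (fun x hx => ?_) ?_
  · rw [mem_preannihilator] at hx
    by_contra hxR
    obtain ⟨f, hf, hfx⟩ := exists_dual_eq_zero_of_notMem hT hxR
    exact hfx (hx f (mem_ker_adjoint.2 fun y => hf _ ⟨y, rfl⟩))
  · rintro _ ⟨x, rfl⟩
    exact mem_preannihilator.2 fun f hf => mem_ker_adjoint.1 hf x

/-- The null space of `T*` is the dual of the cokernel of `T`. -/
noncomputable def kerAdjointEquiv (T : E →L[ℂ] E)
    [FiniteDimensional ℂ (E ⧸ (T : E →ₗ[ℂ] E).range)] :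
    (adjoint T : StrongDual ℂ E →ₗ[ℂ] StrongDual ℂ E).ker ≃ₗ[ℂ]
      Module.Dual ℂ (E ⧸ (T : E →ₗ[ℂ] E).range) :=
  LinearEquiv.ofBijective (M := (adjoint T : StrongDual ℂ E →ₗ[ℂ] StrongDual ℂ E).ker)
    { toFun := fun f => (T : E →ₗ[ℂ] E).range.liftQ ((f : StrongDual ℂ E) : E →ₗ[ℂ] ℂ) (by
        rintro _ ⟨x, rfl⟩
        exact mem_ker_adjoint.1 f.2 x)
      map_add' := fun f g => by ext x; rfl
      map_smul' := fun z f => by ext x; rfl }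
    ⟨by
      intro f g hfg
      ext x
      exact congrArg (fun φ : Module.Dual ℂ (E ⧸ (T : E →ₗ[ℂ] E).range) =>
        φ (Submodule.Quotient.mk x)) hfg, by
      intro φ
      have : IsClosed ((T : E →ₗ[ℂ] E).range : Set E) :=
        isClosed_range_of_finiteDimensional_coker T inferInstance
      refine ⟨⟨(LinearMap.toContinuousLinearMap φ).comp (T : E →ₗ[ℂ] E).range.mkQL, ?_⟩, ?_⟩
      · rw [mem_ker_adjoint]
        intro x
        have : (T : E →ₗ[ℂ] E).range.mkQL (T x) = 0 :=
          (Submodule.Quotient.mk_eq_zero _).2 ⟨x, rfl⟩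
        rw [ContinuousLinearMap.comp_apply, this, map_zero]
      · ext x
        rfl⟩

/-- Restriction of functionals to a subspace. -/
noncomputable def restrictDual (N : Submodule ℂ E) : StrongDual ℂ E →ₗ[ℂ] Module.Dual ℂ N where
  toFun f := (f : E →ₗ[ℂ] ℂ).comp N.subtype
  map_add' _ _ := rfl
  map_smul' _ _ := rfl

omit [CompleteSpace E] in
theorem restrictDual_surjective (N : Submodule ℂ E) [FiniteDimensional ℂ N] :
    Function.Surjective (restrictDual N) :=
  (SeparatingDual.dualMap_surjective_iff (f := N.subtype)).2 N.injective_subtype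

/-- The closed range theorem, for finite dimensional null space: `R(T*)` is the annihilator of
`N(T)`. -/
theorem ker_restrictDual_eq_range_adjoint (T : E →L[ℂ] E)
    [FiniteDimensional ℂ (T : E →ₗ[ℂ] E).ker] (hT : IsClosed ((T : E →ₗ[ℂ] E).range : Set E)) :
    (restrictDual (T : E →ₗ[ℂ] E).ker).ker =
      (adjoint T : StrongDual ℂ E →ₗ[ℂ] StrongDual ℂ E).range := by
  refine le_antisymm (fun f hf => ?_) ?_
  · have hf0 : ∀ x, T x = 0 → f x = 0 := fun x hx =>
      congrArg (fun φ : Module.Dual ℂ (T : E →ₗ[ℂ] E).ker => φ ⟨x, hx⟩) (LinearMap.mem_ker.1 hf)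
    obtain ⟨M, hM, hc⟩ := (Submodule.ClosedComplemented.of_finiteDimensional (𝕜 := ℂ)
      (T : E →ₗ[ℂ] E).ker).exists_isClosed_isCompl
    have : CompleteSpace M := hM.completeSpace_coe
    have hdec : ∀ x, ∃ m : M, T m = T x ∧ f m = f x := by
      intro x
      obtain ⟨k, hk, m, hm, rfl⟩ := Submodule.mem_sup.1 (hc.sup_eq_top ▸ Submodule.mem_top (x := x))
      have hk' : T k = 0 := hk
      exact ⟨⟨m, hm⟩, by rw [map_add, hk', zero_add], by rw [map_add, hf0 k hk', zero_add]⟩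
    let S : M →L[ℂ] E := T.comp M.subtypeL
    have hinj : Function.Injective S := by
      rw [injective_iff_map_eq_zero]
      intro m hm
      exact Subtype.ext (Submodule.disjoint_def.1 hc.disjoint _ hm m.2)
    have hrange : Set.range S = ((T : E →ₗ[ℂ] E).range : Set E) := by
      ext y
      constructor
      · rintro ⟨m, rfl⟩; exact ⟨m, rfl⟩
      · rintro ⟨x, rfl⟩
        obtain ⟨m, hm, _⟩ := hdec x
        exact ⟨m, hm⟩
    have hclo : IsClosed (Set.range S) := hrange ▸ hT
    -- `S` is `T` on a closed complement `M` of `N(T)`; extend `f ∘ S⁻¹` from `R(S) = R(T)` to `E`.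
    let e := S.equivRange hinj hclo
    obtain ⟨g, hg, _⟩ := exists_extension_norm_eq _
      ((f.comp M.subtypeL).comp (e.symm : (S : M →ₗ[ℂ] E).range →L[ℂ] M))
    refine ⟨g, ?_⟩
    ext x
    obtain ⟨m, hm, hfm⟩ := hdec x
    have h1 := hg (e m)
    have h2 : ((e m : (S : M →ₗ[ℂ] E).range) : E) = T x := by rw [← hm]; rfl
    rw [h2] at h1
    change g (T x) = f x
    rw [h1, ← hfm]
    simp
  · rintro _ ⟨g, rfl⟩
    rw [LinearMap.mem_ker]
    ext ⟨x, hx⟩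
    change g (T x) = 0
    have hx' : T x = 0 := hx
    rw [hx', map_zero]

/-- The cokernel of `T*` is the dual of the null space of `T`. -/
noncomputable def cokerAdjointEquiv (T : E →L[ℂ] E)
    [FiniteDimensional ℂ (T : E →ₗ[ℂ] E).ker] (hT : IsClosed ((T : E →ₗ[ℂ] E).range : Set E)) :
    (StrongDual ℂ E ⧸ (adjoint T : StrongDual ℂ E →ₗ[ℂ] StrongDual ℂ E).range) ≃ₗ[ℂ]
      Module.Dual ℂ (T : E →ₗ[ℂ] E).ker :=
  (Submodule.quotEquivOfEq _ _ (ker_restrictDual_eq_range_adjoint T hT).symm).trans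
    (LinearMap.quotKerEquivOfSurjective _ (restrictDual_surjective _))

/-- The open mapping theorem for `(f, c) ↦ T f + c`. -/
theorem exists_norm_le_of_range_sup_eq_top {F : Type*} [NormedAddCommGroup F] [NormedSpace ℂ F]
    [CompleteSpace F] (T : F →L[ℂ] F) (C : Submodule ℂ F) [FiniteDimensional ℂ C]
    (h : (T : F →ₗ[ℂ] F).range ⊔ C = ⊤) :
    ∃ K > 0, ∀ g, ∃ f, ∃ c ∈ C, T f + c = g ∧ ‖f‖ ≤ K * ‖g‖ := by
  have : CompleteSpace C := FiniteDimensional.complete ℂ C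
  have hsurj : Function.Surjective (T.coprod C.subtypeL) := by
    intro g
    obtain ⟨_, ⟨f, rfl⟩, c, hc, hg⟩ := Submodule.mem_sup.1 (h ▸ Submodule.mem_top (x := g))
    exact ⟨(f, ⟨c, hc⟩), by simpa using hg⟩
  obtain ⟨K, hK, hpre⟩ := (T.coprod C.subtypeL).exists_preimage_norm_le hsurj
  refine ⟨K, hK, fun g => ?_⟩
  obtain ⟨⟨f, c⟩, hfc, hle⟩ := hpre g
  exact ⟨f, c, c.2, by simpa using hfc, (le_max_left _ _).trans hle⟩

/-- If `R(T*)` has finite codimension, then `N(T)` is finite dimensional and `R(T)` is closed: with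
`C` a complement of `R(T*)`, the operator `T` is bounded below on the annihilator of `C`. -/
theorem finiteDimensional_ker_and_isClosed_range_of_adjoint (T : E →L[ℂ] E)
    (h : FiniteDimensional ℂ
      (StrongDual ℂ E ⧸ (adjoint T : StrongDual ℂ E →ₗ[ℂ] StrongDual ℂ E).range)) :
    FiniteDimensional ℂ (T : E →ₗ[ℂ] E).ker ∧ IsClosed ((T : E →ₗ[ℂ] E).range : Set E) := by
  obtain ⟨C, hC⟩ := (adjoint T : StrongDual ℂ E →ₗ[ℂ] StrongDual ℂ E).range.exists_isCompl
  have hCfin : FiniteDimensional ℂ C := (Submodule.quotientEquivOfIsCompl _ _ hC).finiteDimensional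
  set M := preannihilator (dualPairing E) C with hM
  have hMcl : IsClosed (M : Set E) := isClosed_preannihilator C
  have : CompleteSpace M := hMcl.completeSpace_coe
  obtain ⟨K, hK, hpre⟩ := exists_norm_le_of_range_sup_eq_top (adjoint T) C hC.sup_eq_top
  have hbelow : ∀ x ∈ M, ‖x‖ ≤ K * ‖T x‖ := by
    intro x hx
    rw [hM, mem_preannihilator] at hx
    obtain ⟨g, hg1, hg⟩ := exists_dual_vector'' ℂ x
    obtain ⟨f, c, hc, hfc, hle⟩ := hpre g
    have h1 : g x = f (T x) := by
      rw [← hfc]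
      change f (T x) + c x = f (T x)
      rw [show c x = 0 from hx c hc, add_zero]
    have h2 : ‖g x‖ = ‖x‖ := by rw [hg]; simp
    rw [← h2, h1]
    refine (f.le_opNorm _).trans ?_
    gcongr
    exact hle.trans (mul_le_of_le_one_right hK.le hg1)
  have hdisj : Disjoint (T : E →ₗ[ℂ] E).ker M := by
    rw [Submodule.disjoint_def]
    intro x hx hxM
    have := hbelow x hxM
    have hx' : T x = 0 := hx
    rw [hx', norm_zero, mul_zero] at this
    exact norm_le_zero_iff.1 this
  constructor
  · exact finiteDimensional_of_disjoint_preannihilator (dualPairing E) C hdisj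
  · have hTM : IsClosed ((M.map (T : E →ₗ[ℂ] E) : Submodule ℂ E) : Set E) := by
      have h1 : AntilipschitzWith (Real.toNNReal K) (T.comp M.subtypeL) := by
        refine (T.comp M.subtypeL).antilipschitz_of_bound fun x => ?_
        rw [Real.coe_toNNReal _ hK.le]
        exact hbelow x x.2
      have h2 := h1.isClosed_range (T.comp M.subtypeL).uniformContinuous
      convert h2 using 1
      ext y
      simp
    obtain ⟨D, hD⟩ := M.exists_isCompl
    have hDfin : FiniteDimensional ℂ D := by
      have h1 : FiniteDimensional ℂ (E ⧸ M) :=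
        finiteDimensional_quotient_preannihilator (dualPairing E) C
      exact (Submodule.quotientEquivOfIsCompl _ _ hD).finiteDimensional
    have : (T : E →ₗ[ℂ] E).range = M.map (T : E →ₗ[ℂ] E) ⊔ D.map (T : E →ₗ[ℂ] E) := by
      rw [← Submodule.map_sup, hD.sup_eq_top, Submodule.map_top]
    rw [this]
    exact Submodule.isClosed_sup_finiteDimensional _ _ hTM

theorem isWeyl_adjoint_iff {T : E →L[ℂ] E} :
    IsWeyl (adjoint T : StrongDual ℂ E →ₗ[ℂ] StrongDual ℂ E) ↔ IsWeyl (T : E →ₗ[ℂ] E) := by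
  have key : IsFredholm (T : E →ₗ[ℂ] E) →
      (IsWeyl (adjoint T : StrongDual ℂ E →ₗ[ℂ] StrongDual ℂ E) ↔ IsWeyl (T : E →ₗ[ℂ] E)) := by
    rintro ⟨h1, h2⟩
    have e1 := kerAdjointEquiv T
    have e2 := cokerAdjointEquiv T (isClosed_range_of_finiteDimensional_coker T h2)
    have h3 : FiniteDimensional ℂ (adjoint T : StrongDual ℂ E →ₗ[ℂ] StrongDual ℂ E).ker :=
      e1.symm.finiteDimensional
    have h4 : FiniteDimensional ℂ
        (StrongDual ℂ E ⧸ (adjoint T : StrongDual ℂ E →ₗ[ℂ] StrongDual ℂ E).range) :=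
      e2.symm.finiteDimensional
    unfold IsWeyl IsFredholm index
    rw [e1.finrank_eq, e2.finrank_eq, Subspace.dual_finrank_eq, Subspace.dual_finrank_eq]
    simp only [h1, h2, h3, h4, and_self, true_and]
    omega
  refine ⟨fun h => ?_, fun h => (key h.1).2 h⟩
  obtain ⟨h1, h2⟩ := finiteDimensional_ker_and_isClosed_range_of_adjoint T h.1.2
  have hker : FiniteDimensional ℂ (adjoint T : StrongDual ℂ E →ₗ[ℂ] StrongDual ℂ E).ker := h.1.1
  refine (key ⟨h1, ?_⟩).1 h
  rw [← preannihilator_ker_adjoint h2]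
  exact finiteDimensional_quotient_preannihilator _ _

end FredholmDuality

/-! ### The spectrum of a generalized derivation -/

section BoundarySpectrum

variable {E : Type*} [NormedAddCommGroup E] [NormedSpace ℂ E]

theorem exists_unit_norm_lt_of_not_isBoundedBelow {T : E →L[ℂ] E} (h : ¬ IsBoundedBelow T)
    {c : ℝ} (hc : 0 < c) : ∃ x, ‖x‖ = 1 ∧ ‖T x‖ < c := by
  unfold IsBoundedBelow at h
  push Not at h
  obtain ⟨x, hx⟩ := h c hc
  have hx0 : ‖x‖ ≠ 0 := fun h0 => by
    rw [h0, mul_zero] at hx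
    exact absurd hx (not_lt.2 (norm_nonneg _))
  refine ⟨((‖x‖⁻¹ : ℝ) : ℂ) • x, ?_, ?_⟩
  · rw [norm_smul, Complex.norm_real, norm_inv, norm_norm, inv_mul_cancel₀ hx0]
  · rw [map_smul, norm_smul, Complex.norm_real, norm_inv, norm_norm,
      inv_mul_lt_iff₀ (lt_of_le_of_ne (norm_nonneg x) hx0.symm), mul_comm]
    exact hx

variable [CompleteSpace E]

/-- At a boundary point of the spectrum, `T - z` is not bounded below. -/
theorem not_isBoundedBelow_of_frequently {T : E →L[ℂ] E} (hT : ¬ Function.Bijective T)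
    (h : ∃ᶠ z in 𝓝 (0 : ℂ), Function.Bijective (shift T z)) : ¬ IsBoundedBelow T := by
  rintro ⟨c, hc, hle⟩
  have hsmall : ∀ᶠ z in 𝓝 (0 : ℂ), ‖z‖ < c / 2 := by
    have := (continuous_norm (E := ℂ)).tendsto 0
    rw [norm_zero] at this
    exact this.eventually (gt_mem_nhds (half_pos hc))
  obtain ⟨z, hz, hzc⟩ := (h.and_eventually hsmall).exists
  obtain ⟨u, hu⟩ := ContinuousLinearMap.isUnit_iff_bijective.2 hz
  have hux : ∀ y, shift T z ((↑u⁻¹ : E →L[ℂ] E) y) = y := fun y => by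
    rw [← hu]; exact congrArg (fun f : E →L[ℂ] E => f y) u.mul_inv
  -- `‖(T - z)⁻¹‖ ≤ 2 / c`, so that the ball of radius `c / 2` around `T - z` consists of units.
  have hnorm : ∀ y, ‖(↑u⁻¹ : E →L[ℂ] E) y‖ ≤ 2 / c * ‖y‖ := by
    intro y
    set x := (↑u⁻¹ : E →L[ℂ] E) y with hx
    have h1 : ‖T x‖ ≤ ‖y‖ + ‖z‖ * ‖x‖ := by
      have : T x = y + z • x := by rw [← hux y, shift_apply]; abel
      rw [this, ← norm_smul]
      exact norm_add_le _ _
    have h2 := hle x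
    have h3 : ‖z‖ * ‖x‖ ≤ c / 2 * ‖x‖ := by gcongr
    rw [div_mul_eq_mul_div, le_div_iff₀ hc]
    nlinarith
  apply hT
  have hfac : T = shift T z * (1 + z • (↑u⁻¹ : E →L[ℂ] E)) := by
    rw [← hu, mul_add, mul_one, mul_smul_comm, Units.mul_inv, hu]
    exact (sub_add_cancel _ _).symm
  have hunit : IsUnit (1 + z • (↑u⁻¹ : E →L[ℂ] E)) := by
    rw [← sub_neg_eq_add]
    refine isUnit_one_sub_of_norm_lt_one ?_
    rw [norm_neg, norm_smul]
    have h4 : ‖(↑u⁻¹ : E →L[ℂ] E)‖ ≤ 2 / c :=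
      ContinuousLinearMap.opNorm_le_bound _ (by positivity) hnorm
    calc ‖z‖ * ‖(↑u⁻¹ : E →L[ℂ] E)‖ ≤ ‖z‖ * (2 / c) := by gcongr
      _ < c / 2 * (2 / c) := by gcongr
      _ = 1 := by field_simp
  rw [← ContinuousLinearMap.isUnit_iff_bijective, hfac]
  exact (ContinuousLinearMap.isUnit_iff_bijective.2 hz).mul hunit

theorem not_isBoundedBelow_adjoint_of_frequently {T : E →L[ℂ] E} (hT : ¬ Function.Bijective T)
    (h : ∃ᶠ z in 𝓝 (0 : ℂ), Function.Bijective (shift T z)) : ¬ IsBoundedBelow (adjoint T) := by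
  refine not_isBoundedBelow_of_frequently (mt bijective_adjoint_iff.1 hT) (h.mono fun z hz => ?_)
  rw [← adjoint_shift]
  exact bijective_adjoint_iff.2 hz

theorem not_isBoundedBelow_or_adjoint {T : E →L[ℂ] E} (hT : ¬ Function.Bijective T) :
    ¬ IsBoundedBelow T ∨ ¬ IsBoundedBelow (adjoint T) := by
  by_contra! h
  exact hT (bijective_of_isBoundedBelow h.1 h.2.injective)

theorem notMem_spectrum_add_iff {T : E →L[ℂ] E} {z w : ℂ} :
    z + w ∉ spectrum ℂ T ↔ Function.Bijective (shift (shift T z) w) := by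
  rw [shift_shift, mem_spectrum_iff, not_not]

end BoundarySpectrum

section Derivation

variable {X Y : Type*} [NormedAddCommGroup X] [NormedSpace ℂ X]
  [NormedAddCommGroup Y] [NormedSpace ℂ Y]

theorem genDerivation_apply (A : X →L[ℂ] X) (B : Y →L[ℂ] Y) (U : Y →L[ℂ] X) (y : Y) :
    genDerivation A B U y = A (U y) - U (B y) := rfl

theorem shift_genDerivation (A : X →L[ℂ] X) (B : Y →L[ℂ] Y) (z w : ℂ) :
    shift (genDerivation A B) (z - w) = genDerivation (shift A z) (shift B w) := by
  ext U y
  rw [shift_apply]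
  simp only [genDerivation_apply, shift_apply, sub_apply, smul_apply, map_sub, map_smul, sub_smul]
  abel

variable [CompleteSpace X] [CompleteSpace Y]

omit [CompleteSpace Y] in
/-- Rank one operators `f ⊗ x` with `A x ≈ 0` and `B* f ≈ 0` are approximate null vectors of
`U ↦ A U - U B`. -/
theorem not_bijective_genDerivation_of_left {A : X →L[ℂ] X} {B : Y →L[ℂ] Y}
    (hA : ¬ IsBoundedBelow A) (hB : ¬ IsBoundedBelow (adjoint B)) :
    ¬ Function.Bijective (genDerivation A B) := by
  intro h
  obtain ⟨c, hc, hle⟩ := isBoundedBelow_of_bijective h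
  obtain ⟨x, hx, hAx⟩ := exists_unit_norm_lt_of_not_isBoundedBelow hA (half_pos hc)
  obtain ⟨f, hf, hBf⟩ := exists_unit_norm_lt_of_not_isBoundedBelow hB (half_pos hc)
  have h1 := hle (f.smulRight x)
  have h2 : genDerivation A B (f.smulRight x) = f.smulRight (A x) - (adjoint B f).smulRight x := by
    ext y
    simp [genDerivation_apply, adjoint_apply]
  rw [h2, ContinuousLinearMap.norm_smulRight_apply, hf, hx, one_mul, mul_one] at h1
  have h3 := norm_sub_le (f.smulRight (A x)) ((adjoint B f).smulRight x)
  rw [ContinuousLinearMap.norm_smulRight_apply, ContinuousLinearMap.norm_smulRight_apply, hf, hx,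
    one_mul, mul_one] at h3
  linarith

omit [CompleteSpace Y] in
/-- If `A* f ≈ 0` and `B y ≈ 0`, then the functional `U ↦ f (U y)` almost vanishes on the range of
`U ↦ A U - U B`. -/
theorem not_bijective_genDerivation_of_right {A : X →L[ℂ] X} {B : Y →L[ℂ] Y}
    (hA : ¬ IsBoundedBelow (adjoint A)) (hB : ¬ IsBoundedBelow B) :
    ¬ Function.Bijective (genDerivation A B) := by
  intro h
  obtain ⟨K, hK, hpre⟩ := (genDerivation A B).exists_preimage_norm_le h.2
  -- With `|f x| > 1 / 2` and `‖U‖ ≤ K`, the bound `1 / (8 K)` on `A* f` and `B y` gives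
  -- `|f x| ≤ 1 / 4`.
  have hc : 0 < 1 / (8 * K) := by positivity
  obtain ⟨f, hf, hAf⟩ := exists_unit_norm_lt_of_not_isBoundedBelow hA hc
  obtain ⟨y, hy, hBy⟩ := exists_unit_norm_lt_of_not_isBoundedBelow hB hc
  obtain ⟨g, hg, hgy⟩ := exists_dual_vector ℂ y (by rw [hy]; exact one_ne_zero)
  obtain ⟨x, hx1, hx⟩ := f.exists_lt_apply_of_lt_opNorm (r := 1 / 2) (by rw [hf]; norm_num)
  obtain ⟨U, hU, hUle⟩ := hpre (g.smulRight x)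
  rw [ContinuousLinearMap.norm_smulRight_apply, hg, one_mul] at hUle
  have hUK : ‖U‖ ≤ K := hUle.trans (mul_le_of_le_one_right hK.le hx1.le)
  have h1 : adjoint A f (U y) - f (U (B y)) = f x := by
    have := congrArg (fun V : Y →L[ℂ] X => f (V y)) hU
    simp only [genDerivation_apply, ContinuousLinearMap.smulRight_apply, hgy, hy, map_sub] at this
    rw [adjoint_apply, this]
    simp
  have h2 : ‖adjoint A f (U y)‖ ≤ 1 / (8 * K) * K := by
    refine ((adjoint A f).le_opNorm _).trans ?_
    have : ‖U y‖ ≤ K := by simpa [hy] using (U.le_opNorm y).trans (by rw [hy, mul_one]; exact hUK)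
    gcongr
  have h3 : ‖f (U (B y))‖ ≤ K * (1 / (8 * K)) := by
    refine (f.le_opNorm _).trans ?_
    rw [hf, one_mul]
    refine (U.le_opNorm _).trans ?_
    gcongr
  have h4 : ‖f x‖ ≤ 1 / (8 * K) * K + K * (1 / (8 * K)) := by
    rw [← h1]
    exact (norm_sub_le _ _).trans (add_le_add h2 h3)
  have h5 : 1 / (8 * K) * K = 1 / 8 := by field_simp
  rw [mul_comm K, h5] at h4
  linarith

/-- `σ(A) - σ(B) ⊆ σ(ρ)`. Both points are moved simultaneously until one of them reaches the
boundary of its spectrum. -/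
theorem sub_mem_spectrum_genDerivation {A : X →L[ℂ] X} {B : Y →L[ℂ] Y} {z w : ℂ}
    (hz : z ∈ spectrum ℂ A) (hw : w ∈ spectrum ℂ B) :
    z - w ∈ spectrum ℂ (genDerivation A B) := by
  let C : Set ℂ := {t | z + t ∈ spectrum ℂ A ∧ w + t ∈ spectrum ℂ B}
  have hcl : IsClosed C :=
    ((spectrum.isClosed A).preimage (continuous_const.add continuous_id)).inter
      ((spectrum.isClosed B).preimage (continuous_const.add continuous_id))
  have hC : IsCompact C := by
    refine ((spectrum.isCompact A).image (continuous_id.sub continuous_const :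
      Continuous fun x : ℂ => x - z)).of_isClosed_subset hcl fun t ht => ⟨z + t, ht.1, ?_⟩
    simp
  obtain ⟨t, ⟨htA, htB⟩, hmax⟩ := hC.exists_isMaxOn (f := Complex.re)
    ⟨0, by simpa using hz, by simpa using hw⟩ Complex.continuous_re.continuousOn
  -- Moving further to the right leaves one of the spectra, since the real part of `t` is maximal.
  have hout : ∃ᶠ s in 𝓝 (0 : ℂ), z + t + s ∉ spectrum ℂ A ∨ w + t + s ∉ spectrum ℂ B := by
    have hlim : Tendsto (fun r : ℝ => (r : ℂ)) (𝓝[>] 0) (𝓝 0) := by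
      have := (Complex.continuous_ofReal.tendsto 0).mono_left (nhdsWithin_le_nhds (s := Set.Ioi 0))
      simpa using this
    refine hlim.frequently (Eventually.frequently ?_)
    filter_upwards [self_mem_nhdsWithin] with r hr
    by_contra! hcon
    have h1 : t + r ∈ C := ⟨by rw [← add_assoc]; exact hcon.1, by rw [← add_assoc]; exact hcon.2⟩
    have h2 := hmax h1
    simp only [Set.mem_ofPred_eq, Complex.add_re, Complex.ofReal_re] at h2
    have : (0 : ℝ) < r := hr
    linarith
  have hzw : z - w = (z + t) - (w + t) := by ring
  rw [mem_spectrum_iff, hzw, shift_genDerivation]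
  rw [mem_spectrum_iff] at htA htB
  rcases frequently_or_distrib.1 hout with h | h
  · have hf := h.mono fun s hs => notMem_spectrum_add_iff.1 hs
    have hA1 := not_isBoundedBelow_of_frequently htA hf
    have hA2 := not_isBoundedBelow_adjoint_of_frequently htA hf
    rcases not_isBoundedBelow_or_adjoint htB with hB | hB
    · exact not_bijective_genDerivation_of_right hA2 hB
    · exact not_bijective_genDerivation_of_left hA1 hB
  · have hf := h.mono fun s hs => notMem_spectrum_add_iff.1 hs
    have hB1 := not_isBoundedBelow_of_frequently htB hf
    have hB2 := not_isBoundedBelow_adjoint_of_frequently htB hf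
    rcases not_isBoundedBelow_or_adjoint htA with hA | hA
    · exact not_bijective_genDerivation_of_left hA hB2
    · exact not_bijective_genDerivation_of_right hA hB1

end Derivation

/-! ### Browder's and Weyl's theorems for polaroid operators -/

section Poles

variable {E : Type*} [NormedAddCommGroup E] [NormedSpace ℂ E]

theorem mem_poles_iff {T : E →L[ℂ] E} {z : ℂ} :
    z ∈ poles T ↔ z ∈ spectrum ℂ T ∧ HasStablePowers (shift T z : E →ₗ[ℂ] E) :=
  and_congr_right' (ascent_eq_descent_iff _)

theorem HasStablePowers.bijective_of_injective {V : Type*} [AddCommGroup V] [Module ℂ V]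
    {T : V →ₗ[ℂ] V} (h : HasStablePowers T) (hi : Function.Injective T) : Function.Bijective T := by
  refine ⟨hi, fun x => ?_⟩
  obtain ⟨n, -, hr⟩ := h
  obtain ⟨y, hy⟩ : (T ^ n) x ∈ (T ^ (n + 1)).range := hr ▸ ⟨x, rfl⟩
  refine ⟨y, ?_⟩
  have hin : Function.Injective (T ^ n) := by
    rw [Module.End.coe_pow]
    exact hi.iterate n
  exact hin (by rw [← Module.End.mul_apply, ← pow_succ, hy])

theorem finiteDimensional_ker_pow {V : Type*} [AddCommGroup V] [Module ℂ V] {T : V →ₗ[ℂ] V}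
    (h : FiniteDimensional ℂ T.ker) (n : ℕ) : FiniteDimensional ℂ (T ^ n).ker := by
  induction n with
  | zero =>
    have : (T ^ 0).ker = ⊥ := LinearMap.ker_id
    rw [this]
    infer_instance
  | succ n ih =>
    have h1 : ((T ^ (n + 1)).ker).FG := by
      refine Submodule.fg_of_fg_map_of_fg_inf_ker (T ^ n) ?_ ?_
      · have hle : (T ^ (n + 1)).ker.map (T ^ n) ≤ T.ker := by
          rintro _ ⟨x, hx, rfl⟩
          have hx' : (T ^ (n + 1)) x = 0 := hx
          rwa [LinearMap.mem_ker, ← Module.End.mul_apply, ← pow_succ']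
        have := Submodule.finiteDimensional_of_le hle
        exact Module.Finite.iff_fg.1 this
      · have := Submodule.finiteDimensional_of_le
          (inf_le_right : (T ^ (n + 1)).ker ⊓ (T ^ n).ker ≤ (T ^ n).ker)
        exact Module.Finite.iff_fg.1 this
    exact Module.Finite.iff_fg.2 h1

theorem tendsto_add_nhdsNE (z : ℂ) : Tendsto (fun w => z + w) (𝓝[≠] 0) (𝓝[≠] z) := by
  refine tendsto_nhdsWithin_iff.2 ⟨?_, ?_⟩
  · have : Tendsto (fun w : ℂ => z + w) (𝓝 0) (𝓝 (z + 0)) :=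
      (continuous_const.add continuous_id).tendsto 0
    rw [add_zero] at this
    exact this.mono_left nhdsWithin_le_nhds
  · filter_upwards [self_mem_nhdsWithin] with w hw
    simpa using hw

theorem tendsto_sub_nhdsNE (z : ℂ) : Tendsto (fun w => w - z) (𝓝[≠] z) (𝓝[≠] 0) := by
  refine tendsto_nhdsWithin_iff.2 ⟨?_, ?_⟩
  · have : Tendsto (fun w : ℂ => w - z) (𝓝 z) (𝓝 (z - z)) :=
      (continuous_id.sub continuous_const).tendsto z
    rw [sub_self] at this
    exact this.mono_left nhdsWithin_le_nhds
  · filter_upwards [self_mem_nhdsWithin] with w hw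
    simpa [sub_eq_zero] using hw

theorem mem_iso_iff {K : Set ℂ} {z : ℂ} :
    z ∈ iso K ↔ z ∈ K ∧ ∀ᶠ w in 𝓝[≠] (0 : ℂ), z + w ∉ K := by
  refine and_congr_right fun _ => ?_
  rw [mem_derivedSet, accPt_iff_frequently_nhdsNE, not_frequently]
  refine ⟨fun h => (tendsto_add_nhdsNE z).eventually h, fun h => ?_⟩
  filter_upwards [(tendsto_sub_nhdsNE z).eventually h] with w hw
  rwa [add_sub_cancel] at hw

variable [CompleteSpace E]

theorem mem_iso_spectrum_iff {T : E →L[ℂ] E} {z : ℂ} :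
    z ∈ iso (spectrum ℂ T) ↔
      z ∈ spectrum ℂ T ∧ ∀ᶠ w in 𝓝[≠] (0 : ℂ), Function.Bijective (shift (shift T z) w) := by
  simp only [mem_iso_iff, notMem_spectrum_add_iff]

/-- Poles are isolated in the spectrum, and an injective operator with finite descent is
bijective. -/
theorem poles_subset_isoEigenvalues (T : E →L[ℂ] E) : poles T ⊆ isoEigenvalues T := by
  intro z hz
  rw [mem_poles_iff] at hz
  refine ⟨mem_iso_spectrum_iff.2 ⟨hz.1, hz.2.eventually_bijective⟩, fun hker => ?_⟩
  exact (mem_spectrum_iff T z).1 hz.1 (hz.2.bijective_of_injective (LinearMap.ker_eq_bot.1 hker))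

/-- A pole of finite multiplicity is a finite rank perturbation of an invertible operator. -/
theorem HasStablePowers.isWeyl {T : E →L[ℂ] E} (h : HasStablePowers (T : E →ₗ[ℂ] E))
    (hk : FiniteDimensional ℂ (T : E →ₗ[ℂ] E).ker) : IsWeyl (T : E →ₗ[ℂ] E) := by
  obtain ⟨P, hP, hc, hn, hu⟩ := h.isDrazinInvertible
  obtain ⟨n, hn⟩ := exists_pow_mul_eq_zero hP hc hn
  refine isWeyl_of_bijective_of_finiteDimensional (G := ((T + P : E →L[ℂ] E) : E →ₗ[ℂ] E))
    (ContinuousLinearMap.isUnit_iff_bijective.1 hu) ?_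
  have := finiteDimensional_ker_pow hk n
  refine Submodule.finiteDimensional_of_le (S₂ := ((T : E →ₗ[ℂ] E) ^ n).ker) ?_
  rintro _ ⟨x, rfl⟩
  have h1 : ((T : E →ₗ[ℂ] E) - ((T + P : E →L[ℂ] E) : E →ₗ[ℂ] E)) x = -P x := by simp
  have h2 : (T ^ n) (P x) = 0 := congrArg (fun f : E →L[ℂ] E => f x) hn
  rw [h1, ← ContinuousLinearMap.toLinearMap_pow, LinearMap.mem_ker, map_neg]
  exact neg_eq_zero.2 h2

omit [CompleteSpace E] in
theorem IsWeyl.isBWeyl {T : E →L[ℂ] E} (h : IsWeyl (T : E →ₗ[ℂ] E)) : IsBWeyl T := by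
  have hmem : ∀ x, x ∈ ((T : E →ₗ[ℂ] E) ^ 0).range := fun x => ⟨x, rfl⟩
  refine ⟨0, ?_, ?_⟩
  · have : (((T : E →ₗ[ℂ] E) ^ 0).range : Set E) = Set.univ := Set.eq_univ_of_forall hmem
    rw [this]
    exact isClosed_univ
  · exact (isWeyl_restrict_iff _ (fun x _ => hmem x) (fun x => ⟨0, hmem _⟩)).2 h

theorem isWeyl_of_notMem_spectrum {T : E →L[ℂ] E} {z : ℂ} (h : z ∉ spectrum ℂ T) :
    IsWeyl (shift T z : E →ₗ[ℂ] E) := by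
  rw [mem_spectrum_iff, not_not] at h
  refine isWeyl_of_bijective_of_finiteDimensional h ?_
  rw [sub_self, LinearMap.range_zero]
  infer_instance

theorem browderTheorem_iff (T : E →L[ℂ] E) : BrowderTheorem T ↔ ∀ z ∈ spectrum ℂ T,
    IsWeyl (shift T z : E →ₗ[ℂ] E) → HasStablePowers (shift T z : E →ₗ[ℂ] E) := by
  constructor
  · intro h z hz hw
    by_contra hs
    have h1 : z ∈ spectrum ℂ T \ finitePoles T := ⟨hz, fun hp => hs (mem_poles_iff.1 hp.1).2⟩
    rw [← h] at h1
    exact h1 hw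
  · intro h
    ext z
    constructor
    · intro hz
      refine ⟨by_contra fun hn => hz (isWeyl_of_notMem_spectrum hn), fun hp => hz ?_⟩
      exact (mem_poles_iff.1 hp.1).2.isWeyl hp.2
    · rintro ⟨hz, hp⟩ hw
      exact hp ⟨mem_poles_iff.2 ⟨hz, h z hz hw⟩, hw.1.1⟩

theorem generalizedBrowderTheorem_iff (T : E →L[ℂ] E) : GeneralizedBrowderTheorem T ↔
    ∀ z ∈ spectrum ℂ T, IsBWeyl (shift T z) → HasStablePowers (shift T z : E →ₗ[ℂ] E) := by
  constructor
  · intro h z hz hw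
    by_contra hs
    have h1 : z ∈ spectrum ℂ T \ poles T := ⟨hz, fun hp => hs (mem_poles_iff.1 hp).2⟩
    rw [← h] at h1
    exact h1 hw
  · intro h
    ext z
    constructor
    · intro hz
      refine ⟨by_contra fun hn => hz (isWeyl_of_notMem_spectrum hn).isBWeyl, fun hp => hz ?_⟩
      exact (mem_poles_iff.1 hp).2.isBWeyl
    · rintro ⟨hz, hp⟩ hw
      exact hp (mem_poles_iff.2 ⟨hz, h z hz hw⟩)

/-- Browder's theorem and generalized Browder's theorem are equivalent for every operator. If
`T - z` is B-Weyl but not a pole, then all `T - w` with `w ≠ z` close to `z` are Weyl and not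
invertible, hence poles by Browder's theorem, although poles are isolated in the spectrum. -/
theorem browderTheorem_iff_generalizedBrowderTheorem (T : E →L[ℂ] E) :
    BrowderTheorem T ↔ GeneralizedBrowderTheorem T := by
  rw [browderTheorem_iff, generalizedBrowderTheorem_iff]
  refine ⟨fun h z hz hw => ?_, fun h z hz hw => h z hz hw.isBWeyl⟩
  rcases hw.dichotomy with h1 | ⟨-, h2⟩
  · exfalso
    obtain ⟨w, hw, hw0⟩ :=
      ((eventually_eventually_nhdsWithin.2 h1).and self_mem_nhdsWithin).exists
    rw [IsOpen.nhdsWithin_eq isOpen_compl_singleton hw0] at hw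
    obtain ⟨hnb, hwe⟩ := hw.self_of_nhds
    rw [shift_shift] at hnb hwe
    have hs := h (z + w) ((mem_spectrum_iff _ _).2 hnb) hwe
    have hlim : Tendsto (fun v => w + v) (𝓝[≠] 0) (𝓝 w) :=
      (tendsto_add_nhdsNE w).mono_right nhdsWithin_le_nhds
    obtain ⟨v, hv1, hv2⟩ := (hs.eventually_bijective.and (hlim.eventually hw)).exists
    rw [shift_shift, add_assoc, ← shift_shift] at hv1
    exact hv2.1 hv1
  · exact h2

/-- `T` is polaroid: the isolated points of its spectrum are poles. -/
def IsPolaroid (T : E →L[ℂ] E) : Prop :=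
  ∀ z ∈ iso (spectrum ℂ T), HasStablePowers (shift T z : E →ₗ[ℂ] E)

theorem IsPolaroid.isoEigenvalues_eq_poles {T : E →L[ℂ] E} (h : IsPolaroid T) :
    isoEigenvalues T = poles T :=
  Set.Subset.antisymm (fun z hz => mem_poles_iff.2 ⟨hz.1.1, h z hz.1⟩)
    (poles_subset_isoEigenvalues T)

theorem IsPolaroid.generalizedWeylTheorem_iff {T : E →L[ℂ] E} (h : IsPolaroid T) :
    GeneralizedWeylTheorem T ↔ GeneralizedBrowderTheorem T := by
  rw [GeneralizedWeylTheorem, GeneralizedBrowderTheorem, h.isoEigenvalues_eq_poles]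

theorem IsPolaroid.weylTheorem_iff {T : E →L[ℂ] E} (h : IsPolaroid T) :
    WeylTheorem T ↔ BrowderTheorem T := by
  rw [WeylTheorem, BrowderTheorem, finiteIsoEigenvalues, finitePoles, h.isoEigenvalues_eq_poles]

/-- An isolated point `z` of the spectrum is an eigenvalue, so `T - z` is B-Weyl by generalized
Weyl's theorem; as the `T - w` with `w` near `z` are invertible, `z` is a pole. -/
theorem IsIsoloid.isPolaroid {T : E →L[ℂ] E} (h : IsIsoloid T) (hT : GeneralizedWeylTheorem T) :
    IsPolaroid T := by
  intro z hz
  have hbw : IsBWeyl (shift T z) := by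
    by_contra hn
    have h1 : z ∈ bWeylSpectrum T := hn
    rw [hT] at h1
    exact h1.2 (h ▸ hz)
  rcases hbw.dichotomy with h1 | ⟨-, h2⟩
  · obtain ⟨w, hw1, hw2⟩ := (h1.and (mem_iso_spectrum_iff.1 hz).2).exists
    exact absurd hw2 hw1.1
  · exact h2

theorem hasStablePowers_adjoint_iff {T : E →L[ℂ] E} :
    HasStablePowers (adjoint T : StrongDual ℂ E →ₗ[ℂ] StrongDual ℂ E) ↔
      HasStablePowers (T : E →ₗ[ℂ] E) :=
  ⟨fun h => h.isDrazinInvertible.of_adjoint.hasStablePowers,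
    fun h => h.isDrazinInvertible.adjoint.hasStablePowers⟩

theorem isPolaroid_adjoint_iff {T : E →L[ℂ] E} : IsPolaroid (adjoint T) ↔ IsPolaroid T := by
  unfold IsPolaroid
  simp_rw [spectrum_adjoint, ← adjoint_shift, hasStablePowers_adjoint_iff]

theorem browderTheorem_adjoint_iff {T : E →L[ℂ] E} :
    BrowderTheorem (adjoint T) ↔ BrowderTheorem T := by
  simp_rw [browderTheorem_iff, spectrum_adjoint, ← adjoint_shift, hasStablePowers_adjoint_iff,
    isWeyl_adjoint_iff]

end Poles

/-! ### Generalized derivations are polaroid -/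

section DerivationPolaroid

theorem IsDrazinInvertible.map_sub_map {R₁ R₂ 𝔄 : Type*} [Ring R₁] [Algebra ℂ R₁] [Ring R₂]
    [Algebra ℂ R₂] [NormedRing 𝔄] [NormedAlgebra ℂ 𝔄] [CompleteSpace 𝔄] (f : R₁ →ₐ[ℂ] 𝔄)
    (g : R₂ →ₐ[ℂ] 𝔄) {a : R₁} {b : R₂} (hab : Commute (f a) (g b)) (z : ℂ)
    (hfin : {μ | μ ∈ spectrum ℂ a ∧ μ - z ∈ spectrum ℂ b}.Finite)
    (ha : ∀ μ ∈ spectrum ℂ a, μ - z ∈ spectrum ℂ b →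
      IsDrazinInvertible (a - algebraMap ℂ R₁ μ))
    (hb : ∀ μ ∈ spectrum ℂ a, μ - z ∈ spectrum ℂ b →
      IsDrazinInvertible (b - algebraMap ℂ R₂ (μ - z))) :
    IsDrazinInvertible (f a - g b - algebraMap ℂ 𝔄 z) := by
  refine IsDrazinInvertible.sub_of_commute hab z hfin.toFinset
    (fun μ hμa hμb => hfin.mem_toFinset.2
      ⟨AlgHom.spectrum_apply_subset f a hμa, AlgHom.spectrum_apply_subset g b hμb⟩)
    (fun μ hμ => ?_) (fun μ hμ => ?_)
  · obtain ⟨h1, h2⟩ := hfin.mem_toFinset.1 hμ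
    rw [← f.commutes, ← map_sub]
    exact (ha μ h1 h2).map f.toRingHom
  · obtain ⟨h1, h2⟩ := hfin.mem_toFinset.1 hμ
    rw [← g.commutes, ← map_sub]
    exact (hb μ h1 h2).map g.toRingHom

variable {X Y : Type*} [NormedAddCommGroup X] [NormedSpace ℂ X]
  [NormedAddCommGroup Y] [NormedSpace ℂ Y]

/-- Left multiplication `A ↦ (U ↦ A U)`. -/
noncomputable def postcompHom (X Y : Type*) [NormedAddCommGroup X] [NormedSpace ℂ X]
    [NormedAddCommGroup Y] [NormedSpace ℂ Y] :
    (X →L[ℂ] X) →ₐ[ℂ] ((Y →L[ℂ] X) →L[ℂ] (Y →L[ℂ] X)) where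
  toFun A := ContinuousLinearMap.postcomp Y A
  map_one' := rfl
  map_mul' _ _ := rfl
  map_zero' := by ext U y; simp
  map_add' A A' := by ext U y; simp
  commutes' z := by
    ext U y
    simp [Algebra.algebraMap_eq_smul_one]

/-- Right multiplication `B ↦ (U ↦ U B)`. -/
noncomputable def precompHom (X Y : Type*) [NormedAddCommGroup X] [NormedSpace ℂ X]
    [NormedAddCommGroup Y] [NormedSpace ℂ Y] :
    (Y →L[ℂ] Y)ᵐᵒᵖ →ₐ[ℂ] ((Y →L[ℂ] X) →L[ℂ] (Y →L[ℂ] X)) where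
  toFun B := ContinuousLinearMap.precomp X B.unop
  map_one' := rfl
  map_mul' _ _ := rfl
  map_zero' := by ext U y; simp
  map_add' B B' := by ext U y; simp
  commutes' z := by
    ext U y
    simp [Algebra.algebraMap_eq_smul_one]

theorem spectrum_op_subset (B : Y →L[ℂ] Y) :
    spectrum ℂ (MulOpposite.op B) ⊆ spectrum ℂ B := by
  intro z hz
  rw [spectrum.mem_iff] at hz ⊢
  exact fun h => hz h.op

variable [CompleteSpace X] [CompleteSpace Y]

theorem mem_iso_of_mem_iso_genDerivation {A : X →L[ℂ] X} {B : Y →L[ℂ] Y} {z μ : ℂ}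
    (hz : z ∈ iso (spectrum ℂ (genDerivation A B))) (hA : μ ∈ spectrum ℂ A)
    (hB : μ - z ∈ spectrum ℂ B) : μ ∈ iso (spectrum ℂ A) ∧ μ - z ∈ iso (spectrum ℂ B) := by
  rw [mem_iso_iff] at hz
  rw [mem_iso_iff, mem_iso_iff]
  refine ⟨⟨hA, ?_⟩, hB, ?_⟩
  · filter_upwards [hz.2] with w hw hwA
    refine hw ?_
    have := sub_mem_spectrum_genDerivation hwA hB
    rwa [show μ + w - (μ - z) = z + w by ring] at this
  · have hneg : Tendsto (fun w : ℂ => -w) (𝓝[≠] 0) (𝓝[≠] 0) := by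
      refine tendsto_nhdsWithin_iff.2 ⟨?_, ?_⟩
      · have : Tendsto (fun w : ℂ => -w) (𝓝 0) (𝓝 (-0)) := continuous_neg.tendsto 0
        rw [neg_zero] at this
        exact this.mono_left nhdsWithin_le_nhds
      · filter_upwards [self_mem_nhdsWithin] with w hw
        simpa using hw
    filter_upwards [hneg.eventually hz.2] with w hw hwB
    refine hw ?_
    have := sub_mem_spectrum_genDerivation hA hwB
    rwa [show μ - (μ - z + w) = z + -w by ring] at this

/-- The set is compact and consists of isolated points. -/
theorem finite_of_mem_iso_genDerivation (A : X →L[ℂ] X) (B : Y →L[ℂ] Y) {z : ℂ}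
    (hz : z ∈ iso (spectrum ℂ (genDerivation A B))) :
    {μ | μ ∈ spectrum ℂ A ∧ μ - z ∈ spectrum ℂ B}.Finite := by
  have hKc : IsCompact {μ | μ ∈ spectrum ℂ A ∧ μ - z ∈ spectrum ℂ B} :=
    (spectrum.isCompact A).inter_right
      ((spectrum.isClosed B).preimage (continuous_id.sub continuous_const))
  by_contra hinf
  obtain ⟨μ, hμ, hacc⟩ := Set.Infinite.exists_accPt_of_subset_isCompact hinf hKc subset_rfl
  exact (mem_iso_of_mem_iso_genDerivation hz hμ.1 hμ.2).1.2
    (hacc.mono (principal_mono.2 fun _ h => h.1))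

omit [CompleteSpace X] in
theorem shift_eq_sub_algebraMap (A : X →L[ℂ] X) (μ : ℂ) :
    shift A μ = A - algebraMap ℂ (X →L[ℂ] X) μ := by
  rw [Algebra.algebraMap_eq_smul_one]; rfl

omit [CompleteSpace X] [CompleteSpace Y] in
theorem genDerivation_eq (A : X →L[ℂ] X) (B : Y →L[ℂ] Y) :
    genDerivation A B = postcompHom X Y A - precompHom X Y (MulOpposite.op B) := rfl

omit [CompleteSpace X] [CompleteSpace Y] in
theorem commute_postcompHom_precompHom (A : X →L[ℂ] X) (B : Y →L[ℂ] Y) :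
    Commute (postcompHom X Y A) (precompHom X Y (MulOpposite.op B)) :=
  ContinuousLinearMap.ext fun _ => rfl

/-- The operator `U ↦ A U - U B` is a difference of commuting elements, the images of `A` and of
`B` under algebra homomorphisms. -/
theorem isPolaroid_genDerivation {A : X →L[ℂ] X} {B : Y →L[ℂ] Y} (hA : IsPolaroid A)
    (hB : IsPolaroid B) : IsPolaroid (genDerivation A B) := by
  intro z hz
  have hD : IsDrazinInvertible (postcompHom X Y A - precompHom X Y (MulOpposite.op B) -
      algebraMap ℂ ((Y →L[ℂ] X) →L[ℂ] (Y →L[ℂ] X)) z) := by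
    have h1 := IsDrazinInvertible.map_sub_map (𝔄 := (Y →L[ℂ] X) →L[ℂ] (Y →L[ℂ] X))
      (R₁ := X →L[ℂ] X) (R₂ := (Y →L[ℂ] Y)ᵐᵒᵖ) (postcompHom X Y) (precompHom X Y) (a := A)
      (b := MulOpposite.op B)
    have h2 := h1 (commute_postcompHom_precompHom A B) z
      ((finite_of_mem_iso_genDerivation A B hz).subset fun μ h => ⟨h.1, spectrum_op_subset B h.2⟩)
    refine h2 (fun μ hμa hμb => ?_) (fun μ hμa hμb => ?_)
    · have h := (mem_iso_of_mem_iso_genDerivation hz hμa (spectrum_op_subset B hμb)).1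
      rw [← shift_eq_sub_algebraMap]
      exact (hA μ h).isDrazinInvertible
    · have h := (mem_iso_of_mem_iso_genDerivation hz hμa (spectrum_op_subset B hμb)).2
      have h1 := (hB _ h).isDrazinInvertible.op
      rw [shift_eq_sub_algebraMap] at h1
      exact h1
  rw [← genDerivation_eq, ← shift_eq_sub_algebraMap] at hD
  exact hD.hasStablePowers

end DerivationPolaroid

end WeylBrowder

theorem theorem5p3 {X Y : Type*}
    [NormedAddCommGroup X] [NormedSpace ℂ X] [CompleteSpace X]
    [NormedAddCommGroup Y] [NormedSpace ℂ Y] [CompleteSpace Y]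
    (A : X →L[ℂ] X) (B : Y →L[ℂ] Y)
    (hA : WeylBrowder.IsIsoloid A) (hA' : WeylBrowder.GeneralizedWeylTheorem A)
    (hB : WeylBrowder.IsIsoloid (WeylBrowder.adjoint B))
    (hB' : WeylBrowder.GeneralizedWeylTheorem (WeylBrowder.adjoint B)) :
    List.TFAE [
      WeylBrowder.GeneralizedWeylTheorem (WeylBrowder.genDerivation A B),
      WeylBrowder.BrowderTheorem (WeylBrowder.genDerivation A B),
      WeylBrowder.GeneralizedBrowderTheorem (WeylBrowder.genDerivation A B),
      WeylBrowder.BrowderTheorem (WeylBrowder.adjoint (WeylBrowder.genDerivation A B)),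
      WeylBrowder.GeneralizedBrowderTheorem (WeylBrowder.adjoint (WeylBrowder.genDerivation A B)),
      WeylBrowder.GeneralizedWeylTheorem (WeylBrowder.adjoint (WeylBrowder.genDerivation A B)),
      WeylBrowder.WeylTheorem (WeylBrowder.genDerivation A B),
      WeylBrowder.WeylTheorem (WeylBrowder.adjoint (WeylBrowder.genDerivation A B))] := by
  have hpol : WeylBrowder.IsPolaroid (WeylBrowder.genDerivation A B) :=
    WeylBrowder.isPolaroid_genDerivation (hA.isPolaroid hA')
      (WeylBrowder.isPolaroid_adjoint_iff.1 (hB.isPolaroid hB'))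
  have hpol' := WeylBrowder.isPolaroid_adjoint_iff.2 hpol
  have h23 := WeylBrowder.browderTheorem_iff_generalizedBrowderTheorem
    (WeylBrowder.genDerivation A B)
  have h45 := WeylBrowder.browderTheorem_iff_generalizedBrowderTheorem
    (WeylBrowder.adjoint (WeylBrowder.genDerivation A B))
  have h24 := WeylBrowder.browderTheorem_adjoint_iff (T := WeylBrowder.genDerivation A B)
  tfae_have 1 ↔ 3 := hpol.generalizedWeylTheorem_iff
  tfae_have 2 ↔ 3 := h23
  tfae_have 4 ↔ 2 := h24
  tfae_have 4 ↔ 5 := h45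
  tfae_have 6 ↔ 5 := hpol'.generalizedWeylTheorem_iff
  tfae_have 7 ↔ 2 := hpol.weylTheorem_iff
  tfae_have 8 ↔ 4 := hpol'.weylTheorem_iff
  tfae_finish
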